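/- Let $\Lambda$ be a principal ideal domain, $p\in\Lambda$ a prime element, $B$ a finitely generated $\Lambda$-module and $A\subseteq B$ a submodule with $p^2A=0$. Here a pair $(B;A)$ consists of a $\Lambda$-module $B$ and a submodule $A$ of $B$; an isomorphism $(B;A)\cong(D;C)$ is a $\Lambda$-isomorphism $f\colon B\to D$ with $f(A)=C$; the pair $(B;A)$ is the direct sum of the pairs $(B_i;A\cap B_i)$ given by submodules $B_i\subseteq B$ if $B=\bigoplus_i B_i$ and $A=\bigoplus_i (A\cap B_i)$; and a pair is indecomposable if its ambient module is nonzero and it is not the direct sum of two pairs with nonzero ambient modules. Consider the following pairs: (a) $(\Lambda/(q);0)$, where $q$ is a prime power (with positive exponent) relatively prime to $p$; (b) the pickets $P^\ell_m=(\Lambda/(p^\ell);\,p^{\ell-m}\Lambda/(p^\ell))$ with $\ell\ge 1$ and $0\le m\le\min(\ell,2)$, and the pairs $Q^t_s=\bigl(\Lambda/(p^t)\oplus\Lambda/(p^s);\,(p^{t-2},p^{s-1})\Lambda\bigr)$ with $1\le s<t-1$; (c) $(\Lambda;0)$. All these pairs are indecomposable. The pair $(B;A)$ is a direct sum of finitely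 many indecomposable pairs, each isomorphic to a pair in (a), (b) or (c). This decomposition is unique up to isomorphism and reordering: for any two decompositions of $(B;A)$ into finitely many indecomposable pairs there is a bijection between the summands such that corresponding summands are isomorphic. -/

import Mathlib

universe u v

/-! A pair `(B; A)` consists of a `Λ`-module `B` and a submodule `A` of `B`. Since the type of
`A : Submodule Λ B` mentions `B`, a pair is given by the term `A`. -/

namespace SubPair

section Basic

variable {Λ : Type*} [CommRing Λ] {B : Type*} [AddCommGroup B] [Module Λ B]
  {D : Type*} [AddCommGroup D] [Module Λ D]

/-- The pairs `(B; A)` and `(D; C)` are isomorphic: there is an isomorphism `B → D` of modules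
that maps `A` onto `C`. -/
def Iso (A : Submodule Λ B) (C : Submodule Λ D) : Prop :=
  ∃ e : B ≃ₗ[Λ] D, A.map (e : B →ₗ[Λ] D) = C

/-- The pair `(B; A)` is the (internal) direct sum of the pairs `(N i; A ∩ N i)`: the module `B`
is the direct sum of the submodules `N i`, and `A` is the sum of the `A ∩ N i`. -/
structure IsDirectSum {ι : Type*} (A : Submodule Λ B) (N : ι → Submodule Λ B) : Prop where
  indep : iSupIndep N
  iSup_eq_top : ⨆ i, N i = ⊤
  iSup_inf_eq : ⨆ i, A ⊓ N i = A

/-- The pair `(B; A)` is indecomposable: it is nonzero, and in every decomposition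
`(B; A) = (U; A ∩ U) ⊕ (V; A ∩ V)` one of the two summands is zero. -/
def Indecomposable (A : Submodule Λ B) : Prop :=
  Nontrivial B ∧
    ∀ U V : Submodule Λ B, IsCompl U V → (A ⊓ U) ⊔ (A ⊓ V) = A → U = ⊥ ∨ V = ⊥

/-- The summand `(N; A ∩ N)` of `(B; A)`, where `A ∩ N` is regarded as a submodule of `N`. -/
abbrev summand (A N : Submodule Λ B) : Submodule Λ N := A.submoduleOf N

end Basic

section Types

variable {Λ : Type*} [CommRing Λ]

/-- The picket `P^ℓ_m = (Λ/(p^ℓ); p^(ℓ-m) Λ/(p^ℓ))`, for `m ≤ ℓ`: the ambient module has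
length `ℓ` and the submodule has length `m`. -/
def picket (p : Λ) (ℓ m : ℕ) : Submodule Λ (Λ ⧸ Ideal.span {p ^ ℓ}) :=
  Submodule.span Λ {Ideal.Quotient.mk (Ideal.span {p ^ ℓ}) (p ^ (ℓ - m))}

/-- The pair `Q^t_s = (Λ/(p^t) ⊕ Λ/(p^s); (p^(t-2), p^(s-1)) Λ)`, for `1 ≤ s < t - 1`. -/
def qPair (p : Λ) (t s : ℕ) :
    Submodule Λ ((Λ ⧸ Ideal.span {p ^ t}) × (Λ ⧸ Ideal.span {p ^ s})) :=
  Submodule.span Λ {(Ideal.Quotient.mk (Ideal.span {p ^ t}) (p ^ (t - 2)),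
    Ideal.Quotient.mk (Ideal.span {p ^ s}) (p ^ (s - 1)))}

variable {D : Type*} [AddCommGroup D] [Module Λ D]

/-- `(D; C)` is of type `(Λ/(q); 0)` with `q` a prime power relatively prime to `p`. -/
def IsCoprimeType (p : Λ) (C : Submodule Λ D) : Prop :=
  ∃ q : Λ, IsPrimePow q ∧ IsCoprime q p ∧ Iso C (⊥ : Submodule Λ (Λ ⧸ Ideal.span {q}))

/-- `(D; C)` is of type `P^ℓ_m` with `1 ≤ ℓ` and `m ≤ min(ℓ, 2)`. -/
def IsPicketType (p : Λ) (C : Submodule Λ D) : Prop :=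
  ∃ ℓ m : ℕ, 1 ≤ ℓ ∧ m ≤ ℓ ∧ m ≤ 2 ∧ Iso C (picket p ℓ m)

/-- `(D; C)` is of type `Q^t_s` with `1 ≤ s < t - 1`. -/
def IsQType (p : Λ) (C : Submodule Λ D) : Prop :=
  ∃ t s : ℕ, 1 ≤ s ∧ s + 1 < t ∧ Iso C (qPair p t s)

/-- `(D; C)` is of type `(Λ; 0)`. -/
def IsFreeType (C : Submodule Λ D) : Prop :=
  Iso C (⊥ : Submodule Λ Λ)

/-- `(D; C)` is of one of the types in the classification. -/
def IsListed (p : Λ) (C : Submodule Λ D) : Prop :=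
  IsCoprimeType p C ∨ (IsPicketType p C ∨ IsQType p C) ∨ IsFreeType C

end Types

end SubPair

/-! Existence of some decomposition into indecomposables is Noetherian. The classification rests on
one device: an indecomposable pair is recognised by a map that is injective on a candidate summand
`C` and takes the same values on `C` as on `B`, and on `A ⊓ C` as on `A`. The kernel of such a map
complements `C` as a pair, hence is zero (`Indecomposable.injective_of_split`). The maps take values
in the injective module K/Λ, whose p^n-torsion is cyclic, generated by the class of p⁻ⁿ.

If A = 0, the structure of B decides: the pair is (Λ;0) or (Λ/(q);0), possibly with q a power of p.
If pA = 0 ≠ A, a nonzero element of A is divided by the highest possible power of p, which gives a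
pure cyclic submodule and a picket. If pA ≠ 0, there are two cases. Either some x = p^m c in A has
px outside p^(m+2)B, and c generates a picket with m = 2; or multiplication by p always raises
heights in A by at least 2, and an extremal x splits as p^t u + p^s w, where u and w generate a pair
of type Q (`Indecomposable.exists_iso_qPair`).

Uniqueness is Krull–Schmidt for summands of finite length: their endomorphism rings are local by
Fitting's lemma, so they can be exchanged. This argument does not reach (Λ;0), which has infinite
length; the free summands are counted by the rank of Hom(B, Λ). -/

namespace SubPair

/-! ### The injective module K/Λ and its p-power torsion. -/

section InjectiveHull

variable {Λ : Type u} [CommRing Λ] [IsDomain Λ]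

variable (Λ) in
/-- The divisible module `K / Λ`, where `K` is the field of fractions of `Λ`. -/
abbrev FracQuot : Type u := FractionRing Λ ⧸ LinearMap.range (Algebra.linearMap Λ (FractionRing Λ))

/-- The class of `p⁻ⁿ` in `K / Λ`. -/
noncomputable def fracGen (p : Λ) (n : ℕ) : FracQuot Λ :=
  Submodule.Quotient.mk ((algebraMap Λ (FractionRing Λ) p ^ n)⁻¹)

theorem algebraMap_pow_ne_zero {p : Λ} (hp : p ≠ 0) (n : ℕ) :
    algebraMap Λ (FractionRing Λ) p ^ n ≠ 0 :=
  pow_ne_zero _ (by simpa using hp)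

theorem smul_fracGen_eq_zero_iff {p : Λ} (hp : p ≠ 0) {n : ℕ} {r : Λ} :
    r • fracGen p n = 0 ↔ p ^ n ∣ r := by
  have h0 := algebraMap_pow_ne_zero hp n
  rw [fracGen, ← Submodule.Quotient.mk_smul, Submodule.Quotient.mk_eq_zero, Algebra.smul_def]
  constructor
  · rintro ⟨s, hs⟩
    refine ⟨s, IsFractionRing.injective Λ (FractionRing Λ) ?_⟩
    rw [Algebra.linearMap_apply] at hs
    rw [map_mul, map_pow, hs]
    field_simp
  · rintro ⟨s, rfl⟩
    refine ⟨s, ?_⟩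
    rw [Algebra.linearMap_apply, map_mul, map_pow]
    field_simp

theorem pow_smul_fracGen {p : Λ} (hp : p ≠ 0) (k n : ℕ) :
    p ^ k • fracGen p (n + k) = fracGen p n := by
  have h0 := algebraMap_pow_ne_zero hp n
  have h1 := algebraMap_pow_ne_zero hp k
  rw [fracGen, fracGen, ← Submodule.Quotient.mk_smul, Algebra.smul_def, map_pow, pow_add]
  congr 1
  field_simp

theorem exists_eq_smul_fracGen {p : Λ} (hp : p ≠ 0) {n : ℕ} {z : FracQuot Λ}
    (hz : p ^ n • z = 0) : ∃ r : Λ, z = r • fracGen p n := by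
  have h0 := algebraMap_pow_ne_zero hp n
  induction z using Submodule.Quotient.induction_on with
  | H z =>
    rw [← Submodule.Quotient.mk_smul, Submodule.Quotient.mk_eq_zero] at hz
    obtain ⟨r, hr⟩ := hz
    refine ⟨r, ?_⟩
    rw [fracGen, ← Submodule.Quotient.mk_smul]
    congr 1
    rw [Algebra.linearMap_apply, Algebra.smul_def, map_pow] at hr
    rw [Algebra.smul_def, hr]
    field_simp

/-- Over a principal ideal domain divisibility suffices: a map on the ideal (a) that sends a to the
class of z extends by sending 1 to the class of z/a. -/
theorem baer_fracQuot [IsPrincipalIdealRing Λ] : Module.Baer Λ (FracQuot Λ) := by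
  intro I g
  obtain ⟨a, ha⟩ := (IsPrincipalIdealRing.principal I).principal
  have haI : a ∈ I := ha ▸ Submodule.mem_span_singleton_self a
  by_cases h0 : a = 0
  · refine ⟨0, fun x hx => ?_⟩
    have hx0 : (⟨x, hx⟩ : I) = 0 := by
      subst h0
      ext
      rw [ha] at hx
      simpa using hx
    rw [hx0, map_zero, LinearMap.zero_apply]
  have ha' : algebraMap Λ (FractionRing Λ) a ≠ 0 := by simpa using h0
  obtain ⟨z, hz⟩ := Submodule.Quotient.mk_surjective _ (g ⟨a, haI⟩)
  refine ⟨LinearMap.toSpanSingleton Λ _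
    (Submodule.Quotient.mk ((algebraMap Λ (FractionRing Λ) a)⁻¹ * z)), fun x hx => ?_⟩
  obtain ⟨r, rfl⟩ := Submodule.mem_span_singleton.mp (ha ▸ hx)
  have hr : (⟨r • a, hx⟩ : I) = r • ⟨a, haI⟩ := rfl
  rw [map_smul, hr, map_smul g, ← hz, LinearMap.toSpanSingleton_apply]
  congr 1
  rw [← Submodule.Quotient.mk_smul, Algebra.smul_def]
  congr 1
  field_simp

end InjectiveHull

/-! ### Multiples, heights and extension of functionals. -/

section Extension

variable {Λ : Type u} [CommRing Λ] {B : Type v} [AddCommGroup B] [Module Λ B]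

/-- The submodule `r B` of the multiples of `r`. -/
abbrev multiples (r : Λ) (B : Type v) [AddCommGroup B] [Module Λ B] : Submodule Λ B :=
  LinearMap.range (r • (LinearMap.id : B →ₗ[Λ] B))

theorem mem_multiples {r : Λ} {b : B} : b ∈ multiples r B ↔ ∃ c, r • c = b := by
  simp [LinearMap.mem_range]

theorem smul_mem_multiples (r : Λ) (b : B) : r • b ∈ multiples r B :=
  mem_multiples.mpr ⟨b, rfl⟩

theorem multiples_mono {r s : Λ} (h : r ∣ s) : multiples s B ≤ multiples r B := by
  obtain ⟨q, rfl⟩ := h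
  intro b hb
  obtain ⟨c, rfl⟩ := mem_multiples.mp hb
  rw [mul_smul]
  exact smul_mem_multiples _ _

theorem pow_smul_mem_multiples (p : Λ) {m n : ℕ} (h : n ≤ m) (b : B) :
    p ^ m • b ∈ multiples (p ^ n) B :=
  multiples_mono (pow_dvd_pow p h) (smul_mem_multiples _ _)

/-- A linear map `g` with values in `K / Λ` extends along `φ`, with the extension annihilated by
`r`, provided that it vanishes wherever `φ` takes values in `r B`. -/
theorem exists_extension [IsDomain Λ] [IsPrincipalIdealRing Λ] {S : Type*} [AddCommGroup S]
    [Module Λ S] (r : Λ) (φ : S →ₗ[Λ] B) (g : S →ₗ[Λ] FracQuot Λ)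
    (h : ∀ s, φ s ∈ multiples r B → g s = 0) :
    ∃ f : B →ₗ[Λ] FracQuot Λ, (∀ s, f (φ s) = g s) ∧ ∀ b, r • f b = 0 := by
  -- Extending from the image of S in B/rB, rather than in B, is what makes the extension
  -- annihilated by r.
  let ψ : S →ₗ[Λ] B ⧸ multiples r B := (multiples r B).mkQ ∘ₗ φ
  have hψ : LinearMap.ker ψ ≤ LinearMap.ker g := by
    intro s hs
    refine h s ?_
    simpa [ψ] using hs
  obtain ⟨f, hf⟩ := (baer_fracQuot (Λ := Λ)).extension_property ((LinearMap.ker ψ).liftQ ψ le_rfl)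
    (LinearMap.ker_eq_bot.mp (Submodule.ker_liftQ_eq_bot _ _ _ le_rfl))
    ((LinearMap.ker ψ).liftQ g hψ)
  refine ⟨f ∘ₗ (multiples r B).mkQ, fun s => ?_, fun b => ?_⟩
  · exact LinearMap.congr_fun hf (Submodule.Quotient.mk s)
  · rw [← map_smul, LinearMap.comp_apply, Submodule.mkQ_apply,
      (Submodule.Quotient.mk_eq_zero _).mpr (smul_mem_multiples r b), map_zero]

/-- Krull's intersection theorem: an element of every p^n B satisfies x = (pq)x for some q, hence x
= (pq)^k x = 0. -/
theorem exists_notMem_multiples [IsNoetherianRing Λ] [Module.Finite Λ B] {p : Λ} {k : ℕ} {x : B}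
    (hx : x ≠ 0) (hpx : p ^ k • x = 0) : ∃ n, x ∉ multiples (p ^ n) B := by
  by_contra! hall
  have hmem : x ∈ (⨅ i : ℕ, Ideal.span {p} ^ i • ⊤ : Submodule Λ B) := by
    rw [Submodule.mem_iInf]
    intro i
    obtain ⟨c, hc⟩ := mem_multiples.mp (hall i)
    rw [← hc, Ideal.span_singleton_pow]
    exact Submodule.smul_mem_smul (Ideal.mem_span_singleton_self _) trivial
  obtain ⟨⟨r, hr⟩, hrx⟩ := (Ideal.mem_iInf_smul_pow_eq_bot_iff _ x).mp hmem
  obtain ⟨q, rfl⟩ := Ideal.mem_span_singleton.mp hr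
  have hpow : ∀ n, (p * q) ^ n • x = x := by
    intro n
    induction n with
    | zero => simp
    | succ n ih =>
      have hrx' : (p * q) • x = x := hrx
      rw [pow_succ, mul_smul, hrx', ih]
  apply hx
  rw [← hpow k, mul_pow, mul_comm, mul_smul, hpx, smul_zero]

/-- Modulo `p ^ (n + 1)`, every nonzero residue class divides `p ^ n`. -/
theorem exists_mul_add_eq_pow [IsDomain Λ] [IsPrincipalIdealRing Λ] {p : Λ} (hp : Prime p)
    {n : ℕ} {r : Λ} (hr : ¬ p ^ (n + 1) ∣ r) : ∃ a b : Λ, a * r + b * p ^ (n + 1) = p ^ n := by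
  obtain ⟨d, hd⟩ := (IsPrincipalIdealRing.principal (Ideal.span {r, p ^ (n + 1)})).principal
  replace hd : Ideal.span {r, p ^ (n + 1)} = Ideal.span {d} := hd
  have hdr : d ∣ r := Ideal.mem_span_singleton.mp
    (hd ▸ Ideal.subset_span (Set.mem_insert _ _) : r ∈ Ideal.span {d})
  have hdp : d ∣ p ^ (n + 1) := Ideal.mem_span_singleton.mp
    (hd ▸ Ideal.subset_span (Set.mem_insert_of_mem _ rfl) : p ^ (n + 1) ∈ Ideal.span {d})
  obtain ⟨i, hi, hdi⟩ := (dvd_prime_pow hp _).mp hdp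
  have hin : i ≤ n := by
    by_contra hlt
    obtain rfl : i = n + 1 := by omega
    exact hr (hdi.symm.dvd.trans hdr)
  have hmem : p ^ n ∈ Ideal.span {r, p ^ (n + 1)} :=
    hd ▸ Ideal.mem_span_singleton.mpr (hdi.dvd.trans (pow_dvd_pow p hin))
  exact Ideal.mem_span_pair.mp hmem

end Extension

/-! ### Isomorphisms of pairs, the splitting criterion, and quotients with given generators. -/

section Iso

variable {Λ : Type*} [CommRing Λ] {B : Type*} [AddCommGroup B] [Module Λ B]
  {D : Type*} [AddCommGroup D] [Module Λ D] {F : Type*} [AddCommGroup F] [Module Λ F]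

theorem Iso.symm {A : Submodule Λ B} {C : Submodule Λ D} (h : Iso A C) : Iso C A := by
  obtain ⟨e, rfl⟩ := h
  refine ⟨e.symm, ?_⟩
  ext x
  simp

theorem Iso.trans {A : Submodule Λ B} {C : Submodule Λ D} {G : Submodule Λ F} (h : Iso A C)
    (h' : Iso C G) : Iso A G := by
  obtain ⟨e, rfl⟩ := h
  obtain ⟨e', rfl⟩ := h'
  refine ⟨e.trans e', ?_⟩
  rw [← Submodule.map_comp]
  rfl

theorem Iso.of_map_span {c : B} {d : D} (e : B ≃ₗ[Λ] D) (h : e c = d) :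
    Iso (Submodule.span Λ {c}) (Submodule.span Λ {d}) :=
  ⟨e, by rw [Submodule.map_span, Set.image_singleton]; simp [h]⟩

/-- A map that restricts to an isomorphism from `C` onto its image, compatibly with `A`, splits off
`C`; in an indecomposable pair it is therefore injective. -/
theorem Indecomposable.injective_of_split {A : Submodule Λ B} (hA : Indecomposable A)
    (f : B →ₗ[Λ] F) (C : Submodule Λ B) (hC : C ≠ ⊥) (hinj : ∀ c ∈ C, f c = 0 → c = 0)
    (hsurj : ∀ b, ∃ c ∈ C, f c = f b) (hAC : ∀ a ∈ A, ∃ c ∈ A ⊓ C, f c = f a) :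
    Function.Injective f := by
  have hcompl : IsCompl C (LinearMap.ker f) := by
    constructor
    · rw [Submodule.disjoint_def]
      exact fun x hx hx' => hinj x hx hx'
    · rw [codisjoint_iff, eq_top_iff]
      intro b _
      obtain ⟨c, hc, hcb⟩ := hsurj b
      have hbc : b - c ∈ LinearMap.ker f := by simp [hcb]
      rw [← add_sub_cancel c b]
      exact Submodule.add_mem_sup hc hbc
  have hsup : (A ⊓ C) ⊔ (A ⊓ LinearMap.ker f) = A := by
    refine le_antisymm (sup_le inf_le_left inf_le_left) fun a ha => ?_
    obtain ⟨c, hc, hca⟩ := hAC a ha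
    have hac : a - c ∈ A ⊓ LinearMap.ker f := ⟨A.sub_mem ha hc.1, by simp [hca]⟩
    rw [← add_sub_cancel c a]
    exact Submodule.add_mem_sup hc hac
  exact LinearMap.ker_eq_bot.mp ((hA.2 _ _ hcompl hsup).resolve_left hC)

/-- The linear map `Λ / (q) → B` that sends `1` to an element `c` with `q c = 0`. -/
def quotLift {q : Λ} {c : B} (h : q • c = 0) : (Λ ⧸ Ideal.span {q}) →ₗ[Λ] B :=
  Submodule.liftQ (Ideal.span {q}) (LinearMap.toSpanSingleton Λ B c) (by
    intro r hr
    obtain ⟨s, rfl⟩ := Ideal.mem_span_singleton.mp hr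
    rw [LinearMap.mem_ker, LinearMap.toSpanSingleton_apply, mul_comm, mul_smul, h, smul_zero])

theorem quotLift_mk {q : Λ} {c : B} (h : q • c = 0) (r : Λ) :
    quotLift h (Ideal.Quotient.mk _ r) = r • c :=
  rfl

theorem exists_equiv_quotient {q : Λ} {c : B} (hgen : ∀ b, ∃ r : Λ, r • c = b)
    (h : q • c = 0) (hann : ∀ r : Λ, r • c = 0 → q ∣ r) :
    ∃ e : (Λ ⧸ Ideal.span {q}) ≃ₗ[Λ] B, ∀ r, e (Ideal.Quotient.mk _ r) = r • c := by
  refine ⟨LinearEquiv.ofBijective (quotLift h) ⟨?_, fun b => ?_⟩, fun r => quotLift_mk h r⟩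
  · rw [← LinearMap.ker_eq_bot, LinearMap.ker_eq_bot']
    intro x hx
    obtain ⟨r, rfl⟩ := Ideal.Quotient.mk_surjective x
    exact Ideal.Quotient.eq_zero_iff_dvd _ _ |>.mpr (hann r hx)
  · obtain ⟨r, hr⟩ := hgen b
    exact ⟨Ideal.Quotient.mk _ r, hr⟩

theorem exists_equiv_quotient_prod {q q' : Λ} {c c' : B}
    (hgen : ∀ b, ∃ r r' : Λ, r • c + r' • c' = b) (h : q • c = 0) (h' : q' • c' = 0)
    (hann : ∀ r r' : Λ, r • c + r' • c' = 0 → q ∣ r ∧ q' ∣ r') :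
    ∃ e : ((Λ ⧸ Ideal.span {q}) × (Λ ⧸ Ideal.span {q'})) ≃ₗ[Λ] B,
      ∀ r r', e (Ideal.Quotient.mk _ r, Ideal.Quotient.mk _ r') = r • c + r' • c' := by
  refine ⟨LinearEquiv.ofBijective ((quotLift h).coprod (quotLift h')) ⟨?_, fun b => ?_⟩,
    fun r r' => rfl⟩
  · rw [← LinearMap.ker_eq_bot, LinearMap.ker_eq_bot']
    rintro ⟨x, y⟩ hx
    obtain ⟨r, rfl⟩ := Ideal.Quotient.mk_surjective x
    obtain ⟨r', rfl⟩ := Ideal.Quotient.mk_surjective y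
    obtain ⟨h1, h2⟩ := hann r r' hx
    exact Prod.ext ((Ideal.Quotient.eq_zero_iff_dvd _ _).mpr h1)
      ((Ideal.Quotient.eq_zero_iff_dvd _ _).mpr h2)
  · obtain ⟨r, r', hr⟩ := hgen b
    exact ⟨(Ideal.Quotient.mk _ r, Ideal.Quotient.mk _ r'), hr⟩

theorem picket_zero (p : Λ) (n : ℕ) : picket p n 0 = ⊥ := by
  rw [picket, Submodule.span_singleton_eq_bot, Nat.sub_zero, Ideal.Quotient.eq_zero_iff_dvd]

end Iso

/-! ### Pickets, and pairs with zero submodule. -/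

section Classification

variable {Λ : Type u} [CommRing Λ] [IsDomain Λ] [IsPrincipalIdealRing Λ]
  {B : Type v} [AddCommGroup B] [Module Λ B] {p : Λ}

/-- Purity of Λc is tested on its socle: if p^(m+1) does not divide r, then p^m c is a multiple of r
c. -/
theorem dvd_of_smul_mem_multiples (hp : Prime p) {m : ℕ} {c : B} (hc : p ^ (m + 1) • c = 0)
    (hmc : p ^ m • c ∉ multiples (p ^ (m + 1)) B) {r : Λ}
    (hr : r • c ∈ multiples (p ^ (m + 1)) B) : p ^ (m + 1) ∣ r := by
  by_contra hnd
  obtain ⟨a, b, hab⟩ := exists_mul_add_eq_pow hp hnd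
  apply hmc
  rw [← hab, add_smul, mul_smul, mul_smul, hc, smul_zero, add_zero]
  exact Submodule.smul_mem _ _ hr

/-- An indecomposable pair is a picket as soon as its ambient module contains a pure cyclic
submodule `Λ c` of length `m + 1` whose part annihilated by `p ^ k` lies in `A`, where
`p ^ k A = 0`. -/
theorem Indecomposable.iso_picket {A : Submodule Λ B} (hA : Indecomposable A) (hp : Prime p)
    {m k : ℕ} (hk : k ≤ m + 1) {c : B} (hc : p ^ (m + 1) • c = 0)
    (hmc : p ^ m • c ∉ multiples (p ^ (m + 1)) B) (hcA : p ^ (m + 1 - k) • c ∈ A)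
    (hAk : ∀ a ∈ A, p ^ k • a = 0) : Iso A (picket p (m + 1) k) := by
  have hann : ∀ {r : Λ}, r • c ∈ multiples (p ^ (m + 1)) B → p ^ (m + 1) ∣ r :=
    dvd_of_smul_mem_multiples hp hc hmc
  obtain ⟨f, hf, hfb⟩ := exists_extension (p ^ (m + 1)) (LinearMap.toSpanSingleton Λ B c)
    (LinearMap.toSpanSingleton Λ _ (fracGen p (m + 1))) (by
      intro r hr
      exact (smul_fracGen_eq_zero_iff hp.ne_zero).mpr (hann hr))
  replace hf : ∀ r : Λ, f (r • c) = r • fracGen p (m + 1) := hf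
  -- The values of f on A lie in the p^k-torsion of K/Λ, which is generated by f(p^(m+1-k) c), a
  -- value already taken on A ∩ Λc.
  have hfA : ∀ a ∈ A, ∃ r : Λ, f a = f (r • p ^ (m + 1 - k) • c) := by
    intro a ha
    obtain ⟨r, hr⟩ := exists_eq_smul_fracGen hp.ne_zero (n := k) (z := f a)
      (by rw [← map_smul, hAk a ha, map_zero])
    refine ⟨r, ?_⟩
    rw [hr, map_smul, hf]
    congr 1
    conv_lhs => rw [← pow_smul_fracGen hp.ne_zero (m + 1 - k) k]
    congr 2
    omega
  have hgen : ∀ b, ∃ r : Λ, f (r • c) = f b := by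
    intro b
    obtain ⟨r, hr⟩ := exists_eq_smul_fracGen hp.ne_zero (hfb b)
    exact ⟨r, by rw [hf, hr]⟩
  have hfinj : Function.Injective f := by
    refine hA.injective_of_split f (Submodule.span Λ {c}) ?_ ?_ ?_ ?_
    · rw [Ne, Submodule.span_singleton_eq_bot]
      rintro rfl
      exact hmc (by simp)
    · intro x hx hfx
      obtain ⟨r, rfl⟩ := Submodule.mem_span_singleton.mp hx
      rw [hf, smul_fracGen_eq_zero_iff hp.ne_zero] at hfx
      obtain ⟨s, rfl⟩ := hfx
      rw [mul_comm, mul_smul, hc, smul_zero]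
    · intro b
      obtain ⟨r, hr⟩ := hgen b
      exact ⟨r • c, Submodule.mem_span_singleton.mpr ⟨r, rfl⟩, hr⟩
    · intro a ha
      obtain ⟨r, hr⟩ := hfA a ha
      refine ⟨r • p ^ (m + 1 - k) • c, ⟨A.smul_mem _ hcA, ?_⟩, hr.symm⟩
      exact Submodule.mem_span_singleton.mpr ⟨r * p ^ (m + 1 - k), mul_smul _ _ _⟩
  obtain ⟨e, he⟩ := exists_equiv_quotient (fun b => (hgen b).imp fun r hr => hfinj hr) hc
    (fun r hr => hann (by rw [hr]; exact Submodule.zero_mem _))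
  have hAspan : A = Submodule.span Λ {p ^ (m + 1 - k) • c} := by
    refine le_antisymm (fun a ha => ?_) ?_
    · obtain ⟨r, hr⟩ := hfA a ha
      exact Submodule.mem_span_singleton.mpr ⟨r, (hfinj hr).symm⟩
    · rwa [Submodule.span_singleton_le_iff_mem]
  rw [hAspan]
  exact (Iso.of_map_span e (he _)).symm

/-- The exact height of a nonzero element of order dividing a power of `p`. -/
theorem exists_pow_smul_eq_and_notMem [Module.Finite Λ B] {k : ℕ} {x : B} (hx : x ≠ 0)
    (hpx : p ^ k • x = 0) : ∃ (n : ℕ) (c : B), p ^ n • c = x ∧ x ∉ multiples (p ^ (n + 1)) B := by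
  classical
  have h := exists_notMem_multiples hx hpx
  have h0 : Nat.find h ≠ 0 := by
    intro h0
    apply Nat.find_spec h
    rw [h0, pow_zero]
    exact mem_multiples.mpr ⟨x, one_smul _ _⟩
  obtain ⟨n, hn⟩ := Nat.exists_eq_succ_of_ne_zero h0
  have hlt := Nat.find_min h (m := n) (by omega)
  rw [not_not] at hlt
  obtain ⟨c, hc⟩ := mem_multiples.mp hlt
  have hspec := Nat.find_spec h
  rw [hn] at hspec
  exact ⟨n, c, hc, hspec⟩

/-- Dividing the socle element x by the largest possible power p^m gives a c that generates a pure
submodule. For k = 0 any socle element of B serves; for k = 1 it must lie in A. -/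
theorem Indecomposable.exists_iso_picket [Module.Finite Λ B] {A : Submodule Λ B}
    (hA : Indecomposable A) (hp : Prime p) {k : ℕ} (hk : k ≤ 1) (hAk : ∀ a ∈ A, p ^ k • a = 0)
    {x : B} (hx : x ≠ 0) (hpx : p • x = 0) (hxA : k = 0 ∨ x ∈ A) :
    ∃ m, Iso A (picket p (m + 1) k) := by
  obtain ⟨m, c, rfl, hmc⟩ := exists_pow_smul_eq_and_notMem (p := p) (k := 1) hx (by simpa using hpx)
  have hc : p ^ (m + 1) • c = 0 := by rw [pow_succ', mul_smul, hpx]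
  refine ⟨m, hA.iso_picket hp (by omega) hc hmc ?_ hAk⟩
  obtain rfl | rfl : k = 0 ∨ k = 1 := by omega
  · rw [Nat.sub_zero, hc]
    exact A.zero_mem
  · simpa using hxA

theorem exists_prime_smul_eq_zero {r : Λ} (hr : r ≠ 0) :
    ∀ {x : B}, x ≠ 0 → r • x = 0 → ∃ (q : Λ) (y : B), Prime q ∧ y ≠ 0 ∧ q • y = 0 := by
  induction r using UniqueFactorizationMonoid.induction_on_prime with
  | h₁ => exact absurd rfl hr
  | h₂ r hu =>
    intro x hx hrx
    exact absurd (hu.smul_eq_zero.mp hrx) hx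
  | h₃ r q hr0 hq ih =>
    intro x hx hrx
    by_cases h : r • x = 0
    · exact ih hr0 hx h
    · exact ⟨q, r • x, hq, h, by rw [← mul_smul, hrx]⟩

theorem Indecomposable.isFreeType_of_isTorsionFree [Module.Finite Λ B] [Module.IsTorsionFree Λ B]
    (hA : Indecomposable (⊥ : Submodule Λ B)) : IsFreeType (⊥ : Submodule Λ B) := by
  have := hA.1
  let b := Module.Free.chooseBasis Λ B
  obtain ⟨i⟩ := b.index_nonempty
  have hinj : Function.Injective (b.coord i) := by
    refine hA.injective_of_split _ (Submodule.span Λ {b i}) ?_ ?_ ?_ ?_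
    · rw [Ne, Submodule.span_singleton_eq_bot]
      exact b.ne_zero i
    · intro x hx hfx
      obtain ⟨r, rfl⟩ := Submodule.mem_span_singleton.mp hx
      have hr : r = 0 := by simpa using hfx
      rw [hr, zero_smul]
    · intro x
      exact ⟨b.coord i x • b i, Submodule.smul_mem _ _ (Submodule.mem_span_singleton_self _),
        by simp⟩
    · intro a ha
      rw [Submodule.mem_bot] at ha
      exact ⟨0, Submodule.zero_mem _, by rw [ha]⟩
  refine ⟨LinearEquiv.ofBijective (b.coord i) ⟨hinj, fun r => ⟨r • b i, by simp⟩⟩, ?_⟩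
  rw [Submodule.map_bot]

theorem Indecomposable.isListed_bot [Module.Finite Λ B] (hp : Prime p)
    (hA : Indecomposable (⊥ : Submodule Λ B)) : IsListed p (⊥ : Submodule Λ B) := by
  by_cases htf : Module.IsTorsionFree Λ B
  · exact Or.inr (Or.inr hA.isFreeType_of_isTorsionFree)
  have hex : ∃ (r : Λ) (x : B), r ≠ 0 ∧ x ≠ 0 ∧ r • x = 0 := by
    by_contra! h
    exact htf (Module.IsTorsionFree.of_smul_eq_zero fun r x hrx => by
      by_contra! hcon
      exact h r x hcon.1 hcon.2 hrx)
  obtain ⟨r, x, hr, hx, hrx⟩ := hex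
  obtain ⟨q, y, hq, hy, hqy⟩ := exists_prime_smul_eq_zero hr hx hrx
  have hbot : ∀ (q : Λ), ∀ a ∈ (⊥ : Submodule Λ B), q ^ 0 • a = 0 := by simp
  -- If q divides p, then p kills y and the pair is a picket with m = 0. Otherwise q is coprime to
  -- p, and the same picket argument is run with q in place of p.
  by_cases hass : q ∣ p
  · have hpy : p • y = 0 := by
      obtain ⟨s, rfl⟩ := hass
      rw [mul_comm, mul_smul, hqy, smul_zero]
    obtain ⟨m, hm⟩ := hA.exists_iso_picket hp zero_le_one (hbot p) hy hpy (Or.inl rfl)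
    exact Or.inr (Or.inl (Or.inl ⟨m + 1, 0, by omega, by omega, by omega, hm⟩))
  · obtain ⟨m, hm⟩ := hA.exists_iso_picket hq zero_le_one (hbot q) hy hqy (Or.inl rfl)
    rw [picket_zero] at hm
    exact Or.inl ⟨q ^ (m + 1), hq.isPrimePow.pow (by omega),
      ((hq.irreducible.coprime_iff_not_dvd).mpr hass).pow_left, hm⟩

end Classification

/-! ### Pairs of type Q, and the complete list. -/

section QType

variable {Λ : Type u} [CommRing Λ] {B : Type v} [AddCommGroup B] [Module Λ B] {p : Λ}

/-- The numerical data of an element `x` of `A` that generates a summand of type `Q`: the element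
`x` lies in `p ^ s B`, the element `p x` lies in `p ^ (t + 1) B` but not in `p ^ (t + 2) B`, and
`s` is as large as possible. -/
theorem exists_extremal {A : Submodule Λ B}
    (hgap : ∀ x ∈ A, ∀ n, x ∈ multiples (p ^ n) B → p • x ∈ multiples (p ^ (n + 2)) B)
    (hex : ∃ n, ∃ x ∈ A, p • x ∉ multiples (p ^ n) B) :
    ∃ t s : ℕ, s < t ∧ (∃ x ∈ A, x ∈ multiples (p ^ s) B ∧ p • x ∈ multiples (p ^ (t + 1)) B ∧
        p • x ∉ multiples (p ^ (t + 2)) B) ∧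
      ∀ x ∈ A, x ∈ multiples (p ^ (s + 1)) B → p • x ∈ multiples (p ^ (t + 2)) B := by
  classical
  have hzero : ∀ b : B, b ∈ multiples (p ^ 0) B := fun b => mem_multiples.mpr ⟨b, by simp⟩
  -- T is least with pA not inside p^T B, and S is least with p(A ∩ p^S B) inside p^T B. The
  -- conclusion takes t = T - 2 and s = S - 1; the gap hypothesis gives s + 2 < T.
  obtain ⟨T, hT, hTmin⟩ : ∃ T, (∃ x ∈ A, p • x ∉ multiples (p ^ T) B) ∧
      ∀ n < T, ∀ x ∈ A, p • x ∈ multiples (p ^ n) B := by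
    refine ⟨Nat.find hex, Nat.find_spec hex, fun n hn x hx => ?_⟩
    by_contra hcon
    exact Nat.find_min hex hn ⟨x, hx, hcon⟩
  have hS : ∃ S, ∀ x ∈ A, x ∈ multiples (p ^ S) B → p • x ∈ multiples (p ^ T) B :=
    ⟨T, fun x _ hxT => Submodule.smul_mem _ _ hxT⟩
  obtain ⟨S, hS, hSmin⟩ : ∃ S, (∀ x ∈ A, x ∈ multiples (p ^ S) B → p • x ∈ multiples (p ^ T) B) ∧
      ∀ n < S, ∃ x ∈ A, x ∈ multiples (p ^ n) B ∧ p • x ∉ multiples (p ^ T) B := by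
    refine ⟨Nat.find hS, Nat.find_spec hS, fun n hn => ?_⟩
    have := Nat.find_min hS hn
    push Not at this
    exact this
  obtain _ | s := S
  · obtain ⟨x, hx, hxT⟩ := hT
    exact absurd (hS x hx (hzero x)) hxT
  obtain ⟨x, hx, hxs, hxT⟩ := hSmin s (Nat.lt_succ_self s)
  have hlt : s + 2 < T := by
    by_contra hcon
    exact hxT (multiples_mono (pow_dvd_pow p (by omega)) (hgap x hx s hxs))
  obtain ⟨t, rfl⟩ : ∃ t, T = t + 2 := ⟨T - 2, by omega⟩
  exact ⟨t, s, by omega, ⟨x, hx, hxs, hTmin _ (by omega) x hx, hxT⟩, hS⟩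

variable [IsDomain Λ] [IsPrincipalIdealRing Λ]

/-- Functionals f and g are built that are dual to u and w and satisfy g = p f on A. The relation
forces (f, g) to map A into the multiples of the image of x, so that Λu + Λw with the submodule Λx
splits off. -/
theorem Indecomposable.exists_iso_qPair {A : Submodule Λ B} (hA : Indecomposable A)
    (hp : Prime p) (hA2 : ∀ a ∈ A, p ^ 2 • a = 0)
    (hgap : ∀ x ∈ A, ∀ n, x ∈ multiples (p ^ n) B → p • x ∈ multiples (p ^ (n + 2)) B)
    (hex : ∃ n, ∃ x ∈ A, p • x ∉ multiples (p ^ n) B) :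
    ∃ t s : ℕ, 1 ≤ s ∧ s + 1 < t ∧ Iso A (qPair p t s) := by
  have hp0 := hp.ne_zero
  obtain ⟨t, s, hst, ⟨x, hx, hxs, hpxt, hpxt'⟩, hmax⟩ := exists_extremal hgap hex
  obtain ⟨u, hu⟩ := mem_multiples.mp hpxt
  have hpu : p ^ (t + 2) • u = 0 := by
    rw [pow_succ', mul_smul, hu, ← mul_smul, ← sq, hA2 x hx]
  have hus : p ^ t • u ∈ multiples (p ^ (s + 1)) B := pow_smul_mem_multiples p hst u
  have hy : x - p ^ t • u ∉ multiples (p ^ (s + 1)) B := by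
    intro hy
    apply hpxt'
    apply hmax x hx
    rw [← sub_add_cancel x (p ^ t • u)]
    exact Submodule.add_mem _ hy hus
  -- Since px = p^(t+1) u, subtracting p^t u from x leaves an element killed by p. It has height
  -- exactly s, by the maximality of s, and w is its p^s-th part.
  obtain ⟨w, hw⟩ := mem_multiples.mp (Submodule.sub_mem _ hxs
    (pow_smul_mem_multiples p hst.le u))
  rw [← hw] at hy
  have hpw : p ^ (s + 1) • w = 0 := by
    rw [pow_succ', mul_smul, hw, smul_sub, ← hu, pow_succ', mul_smul, sub_self]
  have hxuw : x = p ^ t • u + p ^ s • w := by rw [hw]; abel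
  have hwann : ∀ {r : Λ}, r • w ∈ multiples (p ^ (s + 1)) B → p ^ (s + 1) ∣ r :=
    dvd_of_smul_mem_multiples hp hpw hy
  have hwzero : ∀ {r : Λ}, p ^ (s + 1) ∣ r → r • w = 0 := by
    rintro _ ⟨r, rfl⟩
    rw [mul_comm, mul_smul, hpw, smul_zero]
  have huann : ∀ {r r' : Λ}, r • u + r' • w ∈ multiples (p ^ (t + 2)) B → p ^ (t + 2) ∣ r := by
    intro r r' hrr
    by_contra hnd
    obtain ⟨a, b, hab⟩ := exists_mul_add_eq_pow hp hnd
    have h1 : p ^ (t + 1) • u + (a * r') • w ∈ multiples (p ^ (t + 2)) B := by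
      have h2 := Submodule.smul_mem _ a hrr
      rwa [smul_add, ← mul_smul, ← mul_smul, eq_sub_of_add_eq hab, sub_smul, mul_smul b, hpu,
        smul_zero, sub_zero] at h2
    have h3 : (a * r') • w ∈ multiples (p ^ (s + 1)) B := by
      rw [← add_sub_cancel_left (p ^ (t + 1) • u) ((a * r') • w)]
      exact Submodule.sub_mem _ (multiples_mono (pow_dvd_pow p (by omega)) h1)
        (pow_smul_mem_multiples p (by omega) u)
    rw [hwzero (hwann h3), add_zero, hu] at h1
    exact hpxt' h1
  obtain ⟨f, hf, hfb⟩ := exists_extension (p ^ (t + 2))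
    ((LinearMap.toSpanSingleton Λ B u).coprod (LinearMap.toSpanSingleton Λ B w))
    ((LinearMap.toSpanSingleton Λ _ (fracGen p (t + 2))) ∘ₗ LinearMap.fst Λ Λ Λ) (by
      rintro ⟨r, r'⟩ hr
      exact (smul_fracGen_eq_zero_iff hp0).mpr (huann hr))
  replace hf : ∀ r r' : Λ, f (r • u + r' • w) = r • fracGen p (t + 2) := fun r r' => hf (r, r')
  have hfx : f x = fracGen p 2 := by
    rw [hxuw, hf, add_comm t 2, pow_smul_fracGen hp0]
  have hfA : ∀ a ∈ A, ∃ r : Λ, f a = r • fracGen p 2 := fun a ha =>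
    exists_eq_smul_fracGen hp0 (by rw [← map_smul, hA2 a ha, map_zero])
  have hfmul : ∀ b ∈ multiples (p ^ (t + 2)) B, f b = 0 := by
    intro b hb
    obtain ⟨c, rfl⟩ := mem_multiples.mp hb
    rw [map_smul, hfb]
  have hone : p ^ s • fracGen p (s + 1) = p • fracGen p 2 := by
    rw [add_comm s 1, pow_smul_fracGen hp0]
    simpa using (pow_smul_fracGen hp0 1 1).symm
  -- This is the compatibility needed to prescribe g on A, u and w at once with p^(s+1) g = 0. It
  -- also makes g well defined on the overlap of A with Λu + Λw.
  have hkey : ∀ a ∈ A, ∀ r r' : Λ, a + (r • u + r' • w) ∈ multiples (p ^ (s + 1)) B →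
      p • f a + r' • fracGen p (s + 1) = 0 := by
    intro a ha r r' hmem
    have hr : p ^ (s + 1) ∣ r := by
      obtain ⟨b, hb⟩ := mem_multiples.mp hmem
      obtain ⟨α, hα⟩ := hfA a ha
      obtain ⟨β, hβ⟩ := exists_eq_smul_fracGen hp0 (hfb b)
      have hfab : f (a + (r • u + r' • w)) = f (p ^ (s + 1) • b) := by rw [hb]
      rw [map_add, hf, map_smul, hα, hβ, ← pow_smul_fracGen hp0 t 2, add_comm 2 t, ← mul_smul,
        ← mul_smul, ← add_smul, ← sub_eq_zero, ← sub_smul, smul_fracGen_eq_zero_iff hp0] at hfab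
      have h1 : p ^ (s + 1) ∣ α * p ^ t + r - p ^ (s + 1) * β :=
        (pow_dvd_pow p (by omega)).trans hfab
      have h2 : p ^ (s + 1) ∣ α * p ^ t := (pow_dvd_pow p (by omega)).mul_left α
      have h3 : p ^ (s + 1) ∣ p ^ (s + 1) * β := dvd_mul_right _ _
      have h4 : r = (α * p ^ t + r - p ^ (s + 1) * β) - α * p ^ t + p ^ (s + 1) * β := by ring
      rw [h4]
      exact dvd_add (dvd_sub h1 h2) h3
    have haw : a + r' • w ∈ multiples (p ^ (s + 1)) B := by
      obtain ⟨q, rfl⟩ := hr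
      have h5 := Submodule.sub_mem _ hmem (smul_mem_multiples (p ^ (s + 1)) (q • u))
      rwa [mul_smul, add_left_comm, add_sub_cancel_left] at h5
    have hr' : p ^ s ∣ r' := by
      obtain _ | s := s
      · simp
      -- The former s is now s + 1. Some α a is congruent to -p^s w modulo p^(s+1) B, hence lies in
      -- p^s B. The gap hypothesis puts pα a in p^(s+2) B, which forces p^(s+1) w into it as well,
      -- contrary to `hy`.
      by_contra hnd
      obtain ⟨α, β, hαβ⟩ := exists_mul_add_eq_pow hp hnd
      have h6 : α • a + p ^ s • w - β • p ^ (s + 1) • w ∈ multiples (p ^ (s + 2)) B := by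
        have h7 := Submodule.smul_mem _ α haw
        rwa [smul_add, ← mul_smul, eq_sub_of_add_eq hαβ, sub_smul, mul_smul β,
          ← add_sub_assoc] at h7
      have h8 : α • a ∈ multiples (p ^ s) B := by
        have h9 := Submodule.add_mem _ (Submodule.sub_mem _
          (multiples_mono (pow_dvd_pow p (by omega : s ≤ s + 2)) h6)
          (pow_smul_mem_multiples p (le_refl s) w))
          (pow_smul_mem_multiples p (Nat.le_succ s) (β • w))
        convert h9 using 1
        rw [smul_comm (p ^ (s + 1)) β w]
        abel
      have h10 := hgap _ (A.smul_mem α ha) s h8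
      apply hy
      have h11 := Submodule.sub_mem _ (Submodule.smul_mem _ p h6) h10
      convert h11 using 1
      rw [smul_sub, smul_add, smul_comm p β, ← mul_smul p (p ^ (s + 1)) w, ← pow_succ', hpw,
        smul_zero, sub_zero, add_sub_cancel_left, ← mul_smul, ← pow_succ']
    obtain ⟨m, rfl⟩ := hr'
    have hax : a + m • x ∈ multiples (p ^ (s + 1)) B := by
      have h12 := Submodule.add_mem _ haw (Submodule.smul_mem _ m hus)
      convert h12 using 1
      rw [hxuw, smul_add, mul_comm, mul_smul]
      abel
    -- As a + m x lies in A ∩ p^(s+1) B, extremality puts p(a + m x) in p^(t+2) B, where f vanishes.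
    have h13 := hfmul _ (hmax _ (A.add_mem ha (A.smul_mem m hx)) hax)
    rw [map_smul, map_add, map_smul, hfx, smul_add, smul_comm p m] at h13
    rw [mul_comm, mul_smul, hone, h13]
  obtain ⟨g, hg, hgb⟩ := exists_extension (p ^ (s + 1))
    (A.subtype.coprod
      ((LinearMap.toSpanSingleton Λ B u).coprod (LinearMap.toSpanSingleton Λ B w)))
    ((p • (f ∘ₗ A.subtype)).coprod
      ((LinearMap.toSpanSingleton Λ _ (fracGen p (s + 1))) ∘ₗ LinearMap.snd Λ Λ Λ)) (by
      rintro ⟨⟨a, ha⟩, r, r'⟩ hr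
      exact hkey a ha r r' hr)
  have hgA : ∀ a ∈ A, g a = p • f a := by
    intro a ha
    simpa using hg (⟨a, ha⟩, 0, 0)
  replace hg : ∀ r r' : Λ, g (r • u + r' • w) = r' • fracGen p (s + 1) := by
    intro r r'
    simpa using hg (0, r, r')
  have hmemC : ∀ r r' : Λ, r • u + r' • w ∈ Submodule.span Λ {u, w} := fun r r' =>
    Submodule.mem_span_pair.mpr ⟨r, r', rfl⟩
  have hfg : ∀ b, (f.prod g) b = (f b, g b) := fun _ => rfl
  have hgen : ∀ b, ∃ r r' : Λ, (f.prod g) (r • u + r' • w) = (f.prod g) b := by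
    intro b
    obtain ⟨r, hr⟩ := exists_eq_smul_fracGen hp0 (hfb b)
    obtain ⟨r', hr'⟩ := exists_eq_smul_fracGen hp0 (hgb b)
    exact ⟨r, r', by rw [hfg, hfg, hf, hg, hr, hr']⟩
  have hxA : ∀ a ∈ A, ∃ r : Λ, (f.prod g) (r • x) = (f.prod g) a := by
    intro a ha
    obtain ⟨r, hr⟩ := hfA a ha
    refine ⟨r, ?_⟩
    rw [hfg, hfg, map_smul, map_smul, hgA a ha, hgA x hx, hfx, hr, smul_comm]
  have huw : ∀ r r' : Λ, (f.prod g) (r • u + r' • w) = 0 →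
      p ^ (t + 2) ∣ r ∧ p ^ (s + 1) ∣ r' := by
    intro r r' h
    rw [hfg, hf, hg, Prod.mk_eq_zero] at h
    exact ⟨(smul_fracGen_eq_zero_iff hp0).mp h.1, (smul_fracGen_eq_zero_iff hp0).mp h.2⟩
  have hinj : Function.Injective (f.prod g) := by
    refine hA.injective_of_split _ (Submodule.span Λ {u, w}) ?_ ?_ ?_ ?_
    · intro hbot
      have hu0 : u ∈ Submodule.span Λ {u, w} := by simpa using hmemC 1 0
      rw [hbot, Submodule.mem_bot] at hu0
      apply hpxt'
      rw [← hu, hu0, smul_zero]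
      exact Submodule.zero_mem _
    · intro c hc hc0
      obtain ⟨r, r', rfl⟩ := Submodule.mem_span_pair.mp hc
      obtain ⟨⟨q, rfl⟩, h2⟩ := huw r r' hc0
      rw [hwzero h2, mul_comm, mul_smul, hpu, smul_zero, add_zero]
    · intro b
      obtain ⟨r, r', h⟩ := hgen b
      exact ⟨_, hmemC r r', h⟩
    · intro a ha
      obtain ⟨r, hr⟩ := hxA a ha
      refine ⟨r • x, ⟨A.smul_mem _ hx, Submodule.smul_mem _ _ ?_⟩, hr⟩
      rw [hxuw]
      exact hmemC _ _
  obtain ⟨e, he⟩ := exists_equiv_quotient_prod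
    (fun b => by obtain ⟨r, r', h⟩ := hgen b; exact ⟨r, r', hinj h⟩) hpu hpw
    (fun r r' h => huw r r' (by rw [h, map_zero]))
  have hAspan : A = Submodule.span Λ {x} := by
    refine le_antisymm (fun a ha => ?_) ?_
    · obtain ⟨r, hr⟩ := hxA a ha
      exact Submodule.mem_span_singleton.mpr ⟨r, hinj hr⟩
    · rwa [Submodule.span_singleton_le_iff_mem]
  refine ⟨t + 2, s + 1, by omega, by omega, ?_⟩
  rw [hAspan]
  exact (Iso.of_map_span e (by rw [he, hxuw]; rfl)).symm

/-- Every indecomposable finitely generated pair `(B; A)` with `p² A = 0` is listed. -/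
theorem Indecomposable.isListed [Module.Finite Λ B] (hp : Prime p) {A : Submodule Λ B}
    (hA : Indecomposable A) (hA2 : ∀ a ∈ A, p ^ 2 • a = 0) : IsListed p A := by
  by_cases h1 : ∀ a ∈ A, p • a = 0
  · by_cases h0 : A = ⊥
    · subst h0
      exact hA.isListed_bot hp
    · obtain ⟨x, hx, hx0⟩ := Submodule.exists_mem_ne_zero_of_ne_bot h0
      obtain ⟨m, hm⟩ := hA.exists_iso_picket hp le_rfl (by simpa using h1) hx0 (h1 x hx)
        (Or.inr hx)
      exact Or.inr (Or.inl (Or.inl ⟨m + 1, 1, by omega, by omega, by omega, hm⟩))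
  push Not at h1
  by_cases hgap : ∀ x ∈ A, ∀ n, x ∈ multiples (p ^ n) B → p • x ∈ multiples (p ^ (n + 2)) B
  · obtain ⟨x, hx, hpx⟩ := h1
    obtain ⟨n, hn⟩ := exists_notMem_multiples (p := p) (k := 1) hpx
      (by rw [← mul_smul, ← pow_succ, hA2 x hx])
    exact Or.inr (Or.inl (Or.inr (hA.exists_iso_qPair hp hA2 hgap ⟨n, x, hx, hn⟩)))
  · push Not at hgap
    obtain ⟨x, hx, m, hxm, hpx⟩ := hgap
    obtain ⟨c, rfl⟩ := mem_multiples.mp hxm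
    have hc : p ^ (m + 1 + 1) • c = 0 := by
      rw [add_assoc, add_comm, pow_add, mul_smul]
      exact hA2 _ hx
    -- The failure of the gap hypothesis at x = p^m c says that Λc is pure of length m + 2, and its
    -- p²-torsion is generated by x, which lies in A.
    have hm := hA.iso_picket hp (m := m + 1) (k := 2) (by omega) hc
      (by rwa [pow_succ' p m, mul_smul]) (by simpa using hx) hA2
    exact Or.inr (Or.inl (Or.inl ⟨m + 1 + 1, 2, by omega, by omega, le_rfl, hm⟩))

end QType

/-! ### The listed pairs are indecomposable. -/

section Indecomposability

variable {Λ : Type*} [CommRing Λ] {B : Type*} [AddCommGroup B] [Module Λ B]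
  {D : Type*} [AddCommGroup D] [Module Λ D]

theorem Iso.indecomposable {A : Submodule Λ B} {C : Submodule Λ D} (h : Iso A C)
    (hC : Indecomposable C) : Indecomposable A := by
  obtain ⟨e, rfl⟩ := h
  obtain ⟨hnt, hC⟩ := hC
  refine ⟨e.toEquiv.nontrivial, fun U V hUV hA => ?_⟩
  have hinj : Function.Injective (e : B →ₗ[Λ] D) := e.injective
  have h := hC (U.map (e : B →ₗ[Λ] D)) (V.map (e : B →ₗ[Λ] D)) ?_ ?_
  · simpa [Submodule.map_eq_bot_iff] using h
  · exact (Submodule.orderIsoMapComap e).isCompl hUV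
  · rw [← Submodule.map_inf _ hinj, ← Submodule.map_inf _ hinj, ← Submodule.map_sup, hA]

/-- Every nonzero submodule contains z, so no two of them are disjoint. -/
theorem indecomposable_of_essential {A : Submodule Λ B} {z : B} (hz : z ≠ 0)
    (h : ∀ b : B, b ≠ 0 → ∃ r : Λ, r • b = z) : Indecomposable A := by
  refine ⟨⟨z, 0, hz⟩, fun U V hUV _ => ?_⟩
  by_contra! hne
  have hmem : ∀ W : Submodule Λ B, W ≠ ⊥ → z ∈ W := by
    intro W hW
    obtain ⟨b, hb, hb0⟩ := Submodule.exists_mem_ne_zero_of_ne_bot hW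
    obtain ⟨r, rfl⟩ := h b hb0
    exact W.smul_mem r hb
  exact hz (Submodule.disjoint_def.mp hUV.disjoint z (hmem U hne.1) (hmem V hne.2))

theorem indecomposable_self [IsDomain Λ] (A : Submodule Λ Λ) : Indecomposable A := by
  refine ⟨inferInstance, fun U V hUV _ => ?_⟩
  by_contra! hne
  obtain ⟨x, hx, hx0⟩ := Submodule.exists_mem_ne_zero_of_ne_bot hne.1
  obtain ⟨y, hy, hy0⟩ := Submodule.exists_mem_ne_zero_of_ne_bot hne.2
  refine mul_ne_zero hx0 hy0 (Submodule.disjoint_def.mp hUV.disjoint _ ?_ (V.smul_mem x hy))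
  rw [mul_comm]
  exact U.smul_mem y hx

theorem mk_pow_ne_zero [IsDomain Λ] {p : Λ} (hp : Prime p) (n : ℕ) :
    Ideal.Quotient.mk (Ideal.span {p ^ (n + 1)}) (p ^ n) ≠ 0 := by
  rw [Ne, Ideal.Quotient.eq_zero_iff_dvd, pow_dvd_pow_iff hp.ne_zero hp.not_isUnit]
  omega

variable [IsDomain Λ] [IsPrincipalIdealRing Λ] {p : Λ}

theorem exists_smul_eq_mk_pow (hp : Prime p) {n : ℕ} {b : Λ ⧸ Ideal.span {p ^ (n + 1)}}
    (hb : b ≠ 0) : ∃ r : Λ, r • b = Ideal.Quotient.mk _ (p ^ n) := by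
  obtain ⟨c, rfl⟩ := Ideal.Quotient.mk_surjective b
  rw [Ne, Ideal.Quotient.eq_zero_iff_dvd] at hb
  obtain ⟨x, y, hxy⟩ := exists_mul_add_eq_pow hp hb
  refine ⟨x, ?_⟩
  rw [← hxy, map_add, (Ideal.Quotient.eq_zero_iff_dvd (p ^ (n + 1)) (y * _)).mpr
    (dvd_mul_left _ _), add_zero]
  rfl

theorem indecomposable_quotient_pow (hp : Prime p) {n : ℕ} (hn : 0 < n)
    (A : Submodule Λ (Λ ⧸ Ideal.span {p ^ n})) : Indecomposable A := by
  obtain ⟨n, rfl⟩ := Nat.exists_eq_succ_of_ne_zero hn.ne'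
  exact indecomposable_of_essential (mk_pow_ne_zero hp n) fun b hb => exists_smul_eq_mk_pow hp hb

/-- If the generator of `Q` lies in one of two complementary summands, the other one is zero. -/
theorem eq_bot_of_qPair_le (hp : Prime p) {t s : ℕ} (hst : s < t)
    {U V : Submodule Λ ((Λ ⧸ Ideal.span {p ^ (t + 2)}) × (Λ ⧸ Ideal.span {p ^ (s + 1)}))}
    (hUV : IsCompl U V) (hU : qPair p (t + 2) (s + 1) ≤ U) : V = ⊥ := by
  have hUV0 := Submodule.disjoint_def.mp hUV.disjoint
  set x : (Λ ⧸ Ideal.span {p ^ (t + 2)}) × (Λ ⧸ Ideal.span {p ^ (s + 1)}) :=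
    (Ideal.Quotient.mk _ (p ^ t), Ideal.Quotient.mk _ (p ^ s)) with hx
  have hxU : x ∈ U := hU (Submodule.mem_span_singleton_self _)
  have hmk : ∀ (q r c : Λ), r • Ideal.Quotient.mk (Ideal.span {q}) c =
    Ideal.Quotient.mk (Ideal.span {q}) (r * c) := fun _ _ _ => rfl
  have hz : ∀ q : Λ, Ideal.Quotient.mk (Ideal.span {q}) q = 0 := fun q =>
    (Ideal.Quotient.eq_zero_iff_dvd q q).mpr dvd_rfl
  have hpx : p • x = (Ideal.Quotient.mk _ (p ^ (t + 1)), 0) := by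
    rw [hx, Prod.smul_mk, hmk, hmk, ← pow_succ', ← pow_succ', hz]
  by_contra hV
  obtain ⟨v, hv, hv0⟩ := Submodule.exists_mem_ne_zero_of_ne_bot hV
  -- The socle of the first factor is generated by p x, which lies in U; hence V meets that factor
  -- trivially.
  have hsoc : ∀ c, (c, 0) ∈ V → c = 0 := by
    intro c hc
    by_contra hc0
    obtain ⟨r, hr⟩ := exists_smul_eq_mk_pow hp hc0
    have hpxV : p • x ∈ V := by
      rw [hpx, ← hr, ← smul_zero r, ← Prod.smul_mk]
      exact V.smul_mem r hc
    have hpx0 := hUV0 _ (U.smul_mem p hxU) hpxV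
    rw [hpx] at hpx0
    exact mk_pow_ne_zero hp (t + 1) (congrArg Prod.fst hpx0)
  have hv2 : v.2 ≠ 0 := by
    intro h2
    have hv1 : v = (v.1, 0) := Prod.ext rfl h2
    rw [hv1] at hv
    exact hv0 (hv1.trans (Prod.ext (hsoc _ hv) rfl))
  obtain ⟨r, hr⟩ := exists_smul_eq_mk_pow hp hv2
  obtain ⟨c, hc⟩ := Ideal.Quotient.mk_surjective (r • v.1)
  have hv' : (Ideal.Quotient.mk _ c, Ideal.Quotient.mk _ (p ^ s)) ∈ V := by
    rw [hc, ← hr]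
    exact V.smul_mem r hv
  have hct : p ^ (t + 1) ∣ c := by
    have hpv := V.smul_mem p hv'
    rw [Prod.smul_mk, hmk, hmk, ← pow_succ', hz] at hpv
    have hdvd := (Ideal.Quotient.eq_zero_iff_dvd _ _).mp (hsoc _ hpv)
    rw [pow_succ'] at hdvd
    exact (mul_dvd_mul_iff_left hp.ne_zero).mp hdvd
  have hd : p ^ (s + 1) ∣ c - p ^ t :=
    dvd_sub ((pow_dvd_pow p (by omega)).trans hct) (pow_dvd_pow p hst)
  -- The elements x of U and (c, p^s) of V differ by (c - p^t)(1, 0). Splitting (1, 0) along U and V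
  -- yields an element of U ∩ V whose second coordinate is still p^s, because c - p^t kills the
  -- second factor.
  obtain ⟨u₁, hu₁, v₁, hv₁, huv⟩ := Submodule.mem_sup.mp
    (hUV.sup_eq_top ▸ Submodule.mem_top : ((Ideal.Quotient.mk _ 1, 0) :
      (Λ ⧸ Ideal.span {p ^ (t + 2)}) × (Λ ⧸ Ideal.span {p ^ (s + 1)})) ∈ U ⊔ V)
  have hsum : x + (c - p ^ t) • u₁ =
      (Ideal.Quotient.mk _ c, Ideal.Quotient.mk _ (p ^ s)) - (c - p ^ t) • v₁ := by
    rw [eq_sub_iff_add_eq, add_assoc, ← smul_add, huv, hx, Prod.smul_mk, hmk, smul_zero,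
      Prod.mk_add_mk, add_zero, ← map_add, mul_one, add_sub_cancel]
  have hzero := hUV0 _ (U.add_mem hxU (U.smul_mem (c - p ^ t) hu₁))
    (hsum ▸ V.sub_mem hv' (V.smul_mem _ hv₁))
  have h2 := congrArg Prod.snd hzero
  obtain ⟨e, he⟩ := Ideal.Quotient.mk_surjective u₁.2
  rw [Prod.snd_add, Prod.smul_snd, ← he, hmk, (Ideal.Quotient.eq_zero_iff_dvd _ _).mpr
    (hd.mul_right e), add_zero] at h2
  exact mk_pow_ne_zero hp s h2

/-- The submodule is cyclic of length 2, so each of its nonzero submodules contains p times the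
generator. It therefore lies wholly in one of the two summands. -/
theorem indecomposable_qPair (hp : Prime p) {t s : ℕ} (hst : s < t) :
    Indecomposable (qPair p (t + 2) (s + 1)) := by
  refine ⟨⟨(0, Ideal.Quotient.mk _ (p ^ s)), 0, fun h =>
    mk_pow_ne_zero hp s (congrArg Prod.snd h)⟩, fun U V hUV hA => ?_⟩
  have key : ∀ W : Submodule Λ ((Λ ⧸ Ideal.span {p ^ (t + 2)}) × (Λ ⧸ Ideal.span {p ^ (s + 1)})),
      qPair p (t + 2) (s + 1) ⊓ W ≠ ⊥ → ((Ideal.Quotient.mk _ (p ^ (t + 1)), 0) :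
        (Λ ⧸ Ideal.span {p ^ (t + 2)}) × (Λ ⧸ Ideal.span {p ^ (s + 1)})) ∈ W := by
    intro W hW
    obtain ⟨w, ⟨hwA, hwW⟩, hw0⟩ := Submodule.exists_mem_ne_zero_of_ne_bot hW
    obtain ⟨r, rfl⟩ := Submodule.mem_span_singleton.mp hwA
    have hr : ¬ p ^ 2 ∣ r := by
      rintro ⟨r, rfl⟩
      apply hw0
      refine Prod.ext ((Ideal.Quotient.eq_zero_iff_dvd _ _).mpr ?_)
        ((Ideal.Quotient.eq_zero_iff_dvd _ _).mpr ?_)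
      · exact ⟨r, by simp only [Nat.add_sub_cancel]; ring⟩
      · exact ⟨p * r, by simp only [Nat.add_sub_cancel]; ring⟩
    obtain ⟨a, b, hab⟩ := exists_mul_add_eq_pow hp (n := 1) hr
    have hmem := W.smul_mem a hwW
    convert hmem using 1
    refine Prod.ext (Ideal.Quotient.eq.mpr (Ideal.mem_span_singleton.mpr ?_))
      ((Ideal.Quotient.eq_zero_iff_dvd _ _).mpr ?_).symm
    · refine ⟨b, ?_⟩
      simp only [smul_eq_mul, Nat.add_sub_cancel]
      linear_combination -p ^ t * hab
    · refine ⟨1 - b * p, ?_⟩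
      simp only [smul_eq_mul, Nat.add_sub_cancel]
      linear_combination p ^ s * hab
  have hdisj : qPair p (t + 2) (s + 1) ⊓ U = ⊥ ∨ qPair p (t + 2) (s + 1) ⊓ V = ⊥ := by
    by_contra! hne
    exact mk_pow_ne_zero hp (t + 1) (congrArg Prod.fst
      (Submodule.disjoint_def.mp hUV.disjoint _ (key U hne.1) (key V hne.2)))
  rcases hdisj with h | h
  · rw [h, bot_sup_eq] at hA
    exact Or.inl (eq_bot_of_qPair_le hp hst hUV.symm (inf_eq_left.mp hA))
  · rw [h, sup_bot_eq] at hA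
    exact Or.inr (eq_bot_of_qPair_le hp hst hUV (inf_eq_left.mp hA))

theorem IsListed.indecomposable (hp : Prime p) {A : Submodule Λ B} (h : IsListed p A) :
    Indecomposable A := by
  rcases h with ⟨q, hq, _, hiso⟩ | (⟨l, m, hl, _, _, hiso⟩ | ⟨t, s, hs, hst, hiso⟩) | hiso
  · obtain ⟨r, k, hr, hk, rfl⟩ := hq
    exact hiso.indecomposable (indecomposable_quotient_pow hr hk _)
  · exact hiso.indecomposable (indecomposable_quotient_pow hp hl _)
  · obtain ⟨s, rfl⟩ : ∃ s', s = s' + 1 := ⟨s - 1, by omega⟩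
    obtain ⟨t, rfl⟩ : ∃ t', t = t' + 2 := ⟨t - 2, by omega⟩
    exact hiso.indecomposable (indecomposable_qPair hp (by omega))
  · exact hiso.indecomposable (indecomposable_self _)

end Indecomposability

/-! ### Existence of a decomposition into indecomposable pairs. -/

section Decomposition

variable {Λ : Type*} [CommRing Λ] {B : Type*} [AddCommGroup B] [Module Λ B]

theorem map_subtype_summand (A W : Submodule Λ B) : (summand A W).map W.subtype = A ⊓ W := by
  rw [summand, Submodule.submoduleOf, Submodule.map_comap_subtype, inf_comm]

theorem exists_split_of_not_indecomposable {A W : Submodule Λ B} (hW : W ≠ ⊥)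
    (h : ¬ Indecomposable (summand A W)) :
    ∃ U V : Submodule Λ B, U ≠ ⊥ ∧ V ≠ ⊥ ∧ Disjoint U V ∧ U ⊔ V = W ∧
      (A ⊓ U) ⊔ (A ⊓ V) = A ⊓ W := by
  have hnt : Nontrivial W := Submodule.nontrivial_iff_ne_bot.mpr hW
  have hinj : Function.Injective W.subtype := W.injective_subtype
  rw [Indecomposable, not_and] at h
  have h' := h hnt
  push Not at h'
  obtain ⟨U, V, hUV, hA, hU, hV⟩ := h'
  have hinf : ∀ X : Submodule Λ W, A ⊓ X.map W.subtype = (summand A W ⊓ X).map W.subtype := by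
    intro X
    rw [Submodule.map_inf _ hinj, map_subtype_summand, inf_assoc,
      inf_eq_right.mpr (Submodule.map_subtype_le W X)]
  refine ⟨U.map W.subtype, V.map W.subtype, ?_, ?_, ?_, ?_, ?_⟩
  · exact fun h0 => hU (Submodule.map_injective_of_injective hinj (by rw [h0, Submodule.map_bot]))
  · exact fun h0 => hV (Submodule.map_injective_of_injective hinj (by rw [h0, Submodule.map_bot]))
  · rw [disjoint_iff, ← Submodule.map_inf _ hinj, hUV.inf_eq_bot, Submodule.map_bot]
  · rw [← Submodule.map_sup, hUV.sup_eq_top, Submodule.map_subtype_top]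
  · rw [hinf, hinf, ← Submodule.map_sup, hA, map_subtype_summand]

theorem iSupIndep_sumElim {ι κ : Type*} {N : ι → Submodule Λ B} {N' : κ → Submodule Λ B}
    (hN : iSupIndep N) (hN' : iSupIndep N') (h : Disjoint (⨆ i, N i) (⨆ j, N' j)) :
    iSupIndep (Sum.elim N N') := by
  rintro (i | j)
  · have hle : ⨆ k, ⨆ (_ : k ≠ Sum.inl i), Sum.elim N N' k ≤
        (⨆ k, ⨆ (_ : k ≠ i), N k) ⊔ ⨆ j, N' j := by
      refine iSup₂_le ?_
      rintro (k | k) hk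
      · exact le_sup_of_le_left (le_iSup₂_of_le k (fun h => hk (h ▸ rfl)) le_rfl)
      · exact le_sup_of_le_right (le_iSup N' k)
    refine Disjoint.mono_right hle ?_
    refine Disjoint.disjoint_sup_right_of_disjoint_sup_left (hN i) (h.mono_left ?_)
    exact sup_le (le_iSup N i) (iSup₂_le fun k _ => le_iSup N k)
  · have hle : ⨆ k, ⨆ (_ : k ≠ Sum.inr j), Sum.elim N N' k ≤
        (⨆ k, ⨆ (_ : k ≠ j), N' k) ⊔ ⨆ i, N i := by
      refine iSup₂_le ?_
      rintro (k | k) hk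
      · exact le_sup_of_le_right (le_iSup N k)
      · exact le_sup_of_le_left (le_iSup₂_of_le k (fun h => hk (h ▸ rfl)) le_rfl)
    refine Disjoint.mono_right hle ?_
    refine Disjoint.disjoint_sup_right_of_disjoint_sup_left (hN' j) (h.symm.mono_left ?_)
    exact sup_le (le_iSup N' j) (iSup₂_le fun k _ => le_iSup N' k)

/-- Every submodule `W`, with the submodule `A ∩ W`, is a finite direct sum of indecomposable
pairs. The proof is by Noetherian induction on a submodule disjoint from `W`. -/
theorem exists_indecomposable_family [IsNoetherian Λ B] (A : Submodule Λ B)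
    (W' : Submodule Λ B) : ∀ W : Submodule Λ B, Disjoint W W' →
      ∃ (k : ℕ) (N : Fin k → Submodule Λ B), (∀ i, Indecomposable (summand A (N i))) ∧
        iSupIndep N ∧ ⨆ i, N i = W ∧ ⨆ i, A ⊓ N i = A ⊓ W := by
  -- Splitting W shrinks it, and descending chains need not stop. The submodule disjoint from each
  -- piece grows instead: V ⊔ W' for U, and U ⊔ W' for V.
  induction W' using WellFoundedGT.induction with
  | ind W' ih =>
  intro W hW
  by_cases hbot : W = ⊥
  · refine ⟨0, fun _ => ⊥, fun i => i.elim0, fun i => i.elim0, ?_, ?_⟩ <;> simp [hbot]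
  by_cases hind : Indecomposable (summand A W)
  · refine ⟨1, fun _ => W, fun _ => hind, ?_, by simp, by simp⟩
    exact iSupIndep_subsingleton _
  obtain ⟨U, V, hU, hV, hUV, hsup, hA⟩ := exists_split_of_not_indecomposable hbot hind
  have hgt : ∀ X : Submodule Λ B, X ≠ ⊥ → X ≤ W → W' < X ⊔ W' := by
    intro X hX hXW
    refine lt_of_le_of_ne le_sup_right fun heq => hX ?_
    have hle : X ≤ W' := heq ▸ le_sup_left
    exact (hW.mono_left hXW).eq_bot_of_le hle
  rw [← hsup] at hW hgt
  obtain ⟨k, N, hN, hNi, hNU, hNA⟩ := ih (V ⊔ W') (hgt V hV le_sup_right) U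
    (Disjoint.disjoint_sup_right_of_disjoint_sup_left hUV hW)
  obtain ⟨l, M, hM, hMi, hMV, hMA⟩ := ih (U ⊔ W') (hgt U hU le_sup_left) V
    (Disjoint.disjoint_sup_right_of_disjoint_sup_left hUV.symm (sup_comm U V ▸ hW))
  let e := finSumFinEquiv (m := k) (n := l)
  refine ⟨k + l, Sum.elim N M ∘ e.symm, fun i => ?_, ?_, ?_, ?_⟩
  · have hall : ∀ j, Indecomposable (summand A (Sum.elim N M j)) := by
      rintro (j | j)
      · exact hN j
      · exact hM j
    exact hall (e.symm i)
  · exact (iSupIndep_sumElim hNi hMi (by rwa [hNU, hMV])).comp e.symm.injective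
  · rw [← hsup, ← hNU, ← hMV]
    exact (e.symm.iSup_comp (g := Sum.elim N M)).trans iSup_sum
  · rw [← hA, ← hNA, ← hMA]
    exact (e.symm.iSup_comp (g := fun j => A ⊓ Sum.elim N M j)).trans iSup_sum

theorem exists_isDirectSum_indecomposable [IsNoetherian Λ B] (A : Submodule Λ B) :
    ∃ (k : ℕ) (N : Fin k → Submodule Λ B), IsDirectSum A N ∧
      ∀ i, Indecomposable (summand A (N i)) := by
  obtain ⟨k, N, hN, hi, hs, hA⟩ := exists_indecomposable_family A ⊥ ⊤ disjoint_bot_right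
  exact ⟨k, N, ⟨hi, hs, hA.trans (inf_top_eq A)⟩, hN⟩

end Decomposition

/-! ### Decompositions as families of projections. -/

section Projections

variable {Λ : Type*} [CommRing Λ] {B : Type*} [AddCommGroup B] [Module Λ B]
  {ι : Type*} [Fintype ι]

/-- The family `π` of endomorphisms of the pair `(B; A)` is the family of projections of a
decomposition with summands `N i`. -/
structure IsProjFamily (A : Submodule Λ B) (N : ι → Submodule Λ B) (π : ι → B →ₗ[Λ] B) :
    Prop where
  mem : ∀ i b, π i b ∈ N i
  apply_self : ∀ i, ∀ b ∈ N i, π i b = b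
  apply_ne : ∀ i j, i ≠ j → ∀ b ∈ N j, π i b = 0
  sum_apply : ∀ b, ∑ i, π i b = b
  mem_sub : ∀ i, ∀ a ∈ A, π i a ∈ A

theorem IsDirectSum.exists_isProjFamily {A : Submodule Λ B} {N : ι → Submodule Λ B}
    (h : IsDirectSum A N) : ∃ π, IsProjFamily A N π := by
  classical
  have hcompl : ∀ i, IsCompl (N i) (⨆ j, ⨆ (_ : j ≠ i), N j) := by
    intro i
    refine ⟨h.indep i, ?_⟩
    rw [codisjoint_iff, eq_top_iff, ← h.iSup_eq_top]
    refine iSup_le fun j => ?_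
    by_cases hj : j = i
    · exact hj ▸ le_sup_left
    · exact le_sup_of_le_right (le_iSup₂_of_le j hj le_rfl)
  let π : ι → B →ₗ[Λ] B := fun i => (N i).projection _ (hcompl i)
  have hself : ∀ i, ∀ b ∈ N i, π i b = b := fun i b hb =>
    Submodule.projection_apply_of_mem_left _ hb
  have hne : ∀ i j, i ≠ j → ∀ b ∈ N j, π i b = 0 := fun i j hij b hb =>
    (Submodule.projection_apply_eq_zero_iff (hcompl i)).mpr
      ((le_iSup₂_of_le j hij.symm le_rfl : N j ≤ _) hb)
  refine ⟨π, fun i b => Submodule.projection_apply_mem _ _, hself, hne, fun b => ?_,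
    fun i a ha => ?_⟩
  · have hb : b ∈ ⨆ i, N i := h.iSup_eq_top ▸ Submodule.mem_top
    induction hb using Submodule.iSup_induction' with
    | mem i x hx =>
      rw [Finset.sum_eq_single i (fun j _ hj => hne j i hj x hx) (by simp), hself i x hx]
    | zero => simp
    | add x y _ _ hx hy => simp only [map_add, Finset.sum_add_distrib, hx, hy]
  · rw [← h.iSup_inf_eq] at ha
    induction ha using Submodule.iSup_induction' with
    | mem j x hx =>
      by_cases hij : i = j
      · subst hij
        rw [hself i x hx.2]
        exact hx.1
      · rw [hne i j hij x hx.2]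
        exact A.zero_mem
    | zero => simp
    | add x y _ _ hx hy =>
      rw [map_add]
      exact A.add_mem hx hy

theorem IsProjFamily.isDirectSum {A : Submodule Λ B} {N : ι → Submodule Λ B}
    {π : ι → B →ₗ[Λ] B} (h : IsProjFamily A N π) : IsDirectSum A N where
  indep := by
    intro i
    rw [Submodule.disjoint_def]
    intro x hx hx'
    have hle : ⨆ j, ⨆ (_ : j ≠ i), N j ≤ LinearMap.ker (π i) :=
      iSup₂_le fun j hj b hb => h.apply_ne i j hj.symm b hb
    rw [← h.apply_self i x hx]
    exact hle hx'
  iSup_eq_top := by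
    rw [eq_top_iff]
    intro b _
    rw [← h.sum_apply b]
    exact Submodule.sum_mem _ fun i _ => Submodule.mem_iSup_of_mem i (h.mem i b)
  iSup_inf_eq := by
    refine le_antisymm (iSup_le fun i => inf_le_left) fun a ha => ?_
    rw [← h.sum_apply a]
    exact Submodule.sum_mem _ fun i _ => Submodule.mem_iSup_of_mem i ⟨h.mem_sub i a ha, h.mem i a⟩

end Projections

/-! ### Fitting's lemma and local endomorphism rings. -/

section Fitting

theorem exists_isUnit_of_sum {R : Type*} [Ring R] (hR : ∀ a : R, IsNilpotent a ∨ IsUnit a)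
    [Nontrivial R] {ι : Type*} (s : Finset ι) (f : ι → R) (h : IsUnit (∑ i ∈ s, f i)) :
    ∃ i ∈ s, IsUnit (f i) := by
  classical
  induction s using Finset.induction_on with
  | empty => simp at h
  | insert i s hi ih =>
    rw [Finset.sum_insert hi] at h
    obtain ⟨w, hw⟩ := h
    have hsum : (↑w⁻¹ : R) * f i + ↑w⁻¹ * ∑ j ∈ s, f j = 1 := by
      rw [← mul_add, ← hw, Units.inv_mul]
    rcases hR (↑w⁻¹ * f i) with hn | hu
    · have hu : IsUnit ((↑w⁻¹ : R) * ∑ j ∈ s, f j) := by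
        rw [← eq_sub_iff_add_eq'] at hsum
        rw [hsum]
        exact hn.isUnit_one_sub
      obtain ⟨j, hj, hju⟩ := ih ((Units.isUnit_units_mul _ _).mp hu)
      exact ⟨j, Finset.mem_insert_of_mem hj, hju⟩
    · exact ⟨i, Finset.mem_insert_self _ _, (Units.isUnit_units_mul _ _).mp hu⟩

variable {Λ : Type*} [CommRing Λ] {B : Type*} [AddCommGroup B] [Module Λ B]

/-- The endomorphism ring of the pair `(B; A)`. -/
def endRing (A : Submodule Λ B) : Subring (Module.End Λ B) where
  carrier := {f | ∀ a ∈ A, f a ∈ A}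
  mul_mem' hf hg a ha := hf _ (hg a ha)
  one_mem' _ ha := ha
  add_mem' hf hg a ha := A.add_mem (hf a ha) (hg a ha)
  zero_mem' _ _ := A.zero_mem
  neg_mem' hf a ha := A.neg_mem (hf a ha)

/-- Fitting's lemma is applied to f on B and to its restriction to A with a common exponent, so that
kernel and image of f^n decompose the pair and not only the module. -/
theorem Indecomposable.isNilpotent_or_isUnit [IsNoetherian Λ B] [IsArtinian Λ B]
    {A : Submodule Λ B} (hA : Indecomposable A) (f : endRing A) : IsNilpotent f ∨ IsUnit f := by
  obtain ⟨f, hf⟩ := f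
  let g : Module.End Λ A := f.restrict hf
  -- The condition n ≥ 1 is needed to pass from injectivity of f^n to that of f.
  obtain ⟨n, ⟨hn1, hn2⟩, hn0⟩ := ((f.eventually_isCompl_ker_pow_range_pow.and
    g.eventually_isCompl_ker_pow_range_pow).and (Filter.eventually_ge_atTop 1)).exists
  have hgn : ∀ (m : ℕ) (a : A), ((g ^ m) a : B) = (f ^ m) a := by
    intro m
    induction m with
    | zero => simp
    | succ m ih =>
      intro a
      rw [pow_succ, pow_succ, Module.End.mul_apply, Module.End.mul_apply, ih]
      rfl
  have hsup : (A ⊓ LinearMap.ker (f ^ n)) ⊔ (A ⊓ LinearMap.range (f ^ n)) = A := by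
    refine le_antisymm (sup_le inf_le_left inf_le_left) fun a ha => ?_
    obtain ⟨y, hy, z, ⟨w, rfl⟩, hyz⟩ := Submodule.mem_sup.mp
      (hn2.sup_eq_top ▸ Submodule.mem_top : (⟨a, ha⟩ : A) ∈ _ ⊔ _)
    refine Submodule.mem_sup.mpr ⟨y, ⟨y.2, ?_⟩, ((g ^ n) w : A), ⟨Subtype.prop _, w, ?_⟩,
      congrArg Subtype.val hyz⟩
    · rw [SetLike.mem_coe, LinearMap.mem_ker, ← hgn, LinearMap.mem_ker.mp hy,
        ZeroMemClass.coe_zero]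
    · exact (hgn n w).symm
  rcases hA.2 _ _ hn1 hsup with h | h
  · right
    have hinj : Function.Injective f := by
      obtain ⟨n, rfl⟩ := Nat.exists_eq_add_of_le' hn0
      have hpow : Function.Injective (f ^ (n + 1)) := LinearMap.ker_eq_bot.mp h
      rw [pow_succ, Module.End.coe_mul] at hpow
      exact hpow.of_comp
    have hginj : Function.Injective g := fun a b hab =>
      Subtype.ext (hinj (congrArg Subtype.val hab))
    have hgsurj := IsArtinian.surjective_of_injective_endomorphism g hginj
    let e := LinearEquiv.ofBijective f
      ⟨hinj, IsArtinian.surjective_of_injective_endomorphism f hinj⟩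
    have hinv : (e.symm : B →ₗ[Λ] B) ∈ endRing A := by
      intro a ha
      obtain ⟨b, hb⟩ := hgsurj ⟨a, ha⟩
      have hab : e b = a := congrArg Subtype.val hb
      rw [← hab, LinearEquiv.coe_coe, LinearEquiv.symm_apply_apply]
      exact b.2
    refine ⟨⟨⟨f, hf⟩, ⟨_, hinv⟩, Subtype.ext ?_, Subtype.ext ?_⟩, rfl⟩
    · exact LinearMap.ext fun b => e.apply_symm_apply b
    · exact LinearMap.ext fun b => e.symm_apply_apply b
  · left
    exact ⟨n, Subtype.ext (LinearMap.range_eq_bot.mp h)⟩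

end Fitting

/-! ### The exchange property. -/

section Exchange

variable {Λ : Type*} [CommRing Λ] {B : Type*} [AddCommGroup B] [Module Λ B]
  {ι κ : Type*} [Fintype ι] [Fintype κ]

/-- A submodule `Y` replaces the summand `N i` of a decomposition if there is an idempotent
endomorphism `τ` of the pair with image `Y` that has the same kernel as the projection onto `N i`. -/
theorem IsProjFamily.isDirectSum_update [DecidableEq ι] {A : Submodule Λ B} {N : ι → Submodule Λ B}
    {π : ι → B →ₗ[Λ] B} (hπ : IsProjFamily A N π) {i : ι} {Y : Submodule Λ B}
    (τ : B →ₗ[Λ] B) (hτY : ∀ b, τ b ∈ Y) (hτself : ∀ y ∈ Y, τ y = y)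
    (hτzero : ∀ b, π i b = 0 → τ b = 0) (hπτ : ∀ b, π i (τ b) = π i b)
    (hτA : ∀ a ∈ A, τ a ∈ A) :
    IsDirectSum A (Function.update N i Y) := by
  -- At i the first term vanishes because π i ∘ τ = π i, so ψ i is τ; the other projections are
  -- applied after removing the Y-component.
  let ψ : ι → B →ₗ[Λ] B := fun j => π j ∘ₗ (LinearMap.id - τ) + if j = i then τ else 0
  have hi : ∀ b, ψ i b = τ b := by
    intro b
    simp [ψ, hπτ]
  have hne : ∀ j, j ≠ i → ∀ b, ψ j b = π j (b - τ b) := by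
    intro j hj b
    simp [ψ, hj]
  have hτN : ∀ j, j ≠ i → ∀ b ∈ N j, τ b = 0 := fun j hj b hb =>
    hτzero b (hπ.apply_ne i j hj.symm b hb)
  refine IsProjFamily.isDirectSum (π := ψ) ⟨fun j b => ?_, fun j b hb => ?_,
    fun j k hjk b hb => ?_, fun b => ?_, fun j a ha => ?_⟩
  · by_cases hj : j = i
    · subst hj
      rw [hi, Function.update_self]
      exact hτY b
    · rw [hne j hj, Function.update_of_ne hj]
      exact hπ.mem j _
  · by_cases hj : j = i
    · subst hj
      rw [Function.update_self] at hb
      rw [hi, hτself b hb]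
    · rw [Function.update_of_ne hj] at hb
      rw [hne j hj, hτN j hj b hb, sub_zero, hπ.apply_self j b hb]
  · by_cases hj : j = i
    · subst hj
      rw [Function.update_of_ne hjk.symm] at hb
      rw [hi, hτN k hjk.symm b hb]
    · rw [hne j hj]
      by_cases hk : k = i
      · subst hk
        rw [Function.update_self] at hb
        rw [hτself b hb, sub_self, map_zero]
      · rw [Function.update_of_ne hk] at hb
        rw [hτN k hk b hb, sub_zero, hπ.apply_ne j k hjk b hb]
  · have hsum := hπ.sum_apply (b - τ b)
    have hite : ∑ j, (if j = i then τ else 0 : B →ₗ[Λ] B) b = τ b := by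
      rw [← LinearMap.sum_apply, Finset.sum_ite_eq' Finset.univ i]
      simp
    simp only [ψ, LinearMap.add_apply, Finset.sum_add_distrib, LinearMap.comp_apply,
      LinearMap.sub_apply, LinearMap.id_apply]
    rw [hsum, hite, sub_add_cancel]
  · by_cases hj : j = i
    · subst hj
      rw [hi]
      exact hτA a ha
    · rw [hne j hj]
      exact hπ.mem_sub j _ (A.sub_mem ha (hτA a ha))

/-- The exchange property of a summand of finite length. -/
theorem IsDirectSum.exchange [DecidableEq ι] {A : Submodule Λ B} {N : ι → Submodule Λ B}
    {N' : κ → Submodule Λ B} (hN : IsDirectSum A N) (hN' : IsDirectSum A N')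
    (hind : ∀ j, Indecomposable (summand A (N' j))) (i : ι) {X : Submodule Λ B} (hX : N i = X)
    [IsNoetherian Λ X] [IsArtinian Λ X] (hXind : Indecomposable (summand A X)) :
    ∃ j, Iso (summand A X) (summand A (N' j)) ∧
      IsDirectSum A (Function.update N i (N' j)) := by
  subst hX
  obtain ⟨π, hπ⟩ := hN.exists_isProjFamily
  obtain ⟨π', hπ'⟩ := hN'.exists_isProjFamily
  let ρ : B →ₗ[Λ] N i := (π i).codRestrict (N i) (hπ.mem i)
  let α : ∀ j, N i →ₗ[Λ] N' j := fun j =>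
    ((π' j).codRestrict (N' j) (hπ'.mem j)) ∘ₗ (N i).subtype
  let β : ∀ j, N' j →ₗ[Λ] N i := fun j => ρ ∘ₗ (N' j).subtype
  have hαA : ∀ j, ∀ x ∈ summand A (N i), α j x ∈ summand A (N' j) := fun j x hx =>
    hπ'.mem_sub j _ hx
  have hβA : ∀ j, ∀ y ∈ summand A (N' j), β j y ∈ summand A (N i) := fun j y hy =>
    hπ.mem_sub i _ hy
  let φ : κ → endRing (summand A (N i)) := fun j =>
    ⟨β j ∘ₗ α j, fun x hx => hβA j _ (hαA j x hx)⟩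
  have hsum : ∑ j, φ j = 1 := by
    refine Subtype.ext (LinearMap.ext fun x => Subtype.ext ?_)
    have hx : π i (∑ j, π' j x) = x := by rw [hπ'.sum_apply, hπ.apply_self i x x.2]
    rw [map_sum] at hx
    rw [AddSubmonoidClass.coe_finsetSum, LinearMap.sum_apply, AddSubmonoidClass.coe_finsetSum]
    exact hx
  have hnt : Nontrivial (N i) := hXind.1
  -- The identity of N i is the sum of the maps through the N' j, so one of these is invertible in
  -- the local endomorphism ring, with inverse θ.
  obtain ⟨j, -, hj⟩ := exists_isUnit_of_sum hXind.isNilpotent_or_isUnit Finset.univ φ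
    (by rw [hsum]; exact isUnit_one)
  obtain ⟨⟨_, ⟨θ, hθ⟩, h1, h2⟩, rfl⟩ := hj
  have hβαθ : ∀ x, β j (α j (θ x)) = x := fun x =>
    LinearMap.congr_fun (congrArg Subtype.val h1) x
  have hθβα : ∀ x, θ (β j (α j x)) = x := fun x =>
    LinearMap.congr_fun (congrArg Subtype.val h2) x
  -- The image of α j splits off N' j as a pair with complement the kernel of β j, which
  -- indecomposability makes zero.
  have hβinj : Function.Injective (β j) := by
    refine (hind j).injective_of_split (β j) (LinearMap.range (α j)) ?_ ?_ ?_ ?_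
    · intro hbot
      obtain ⟨x, hx⟩ := exists_ne (0 : N i)
      apply hx
      have hαx : α j x = 0 := by
        rw [← Submodule.mem_bot Λ, ← hbot]
        exact LinearMap.mem_range_self _ x
      rw [← hθβα x, hαx, map_zero, map_zero]
    · rintro _ ⟨x, rfl⟩ hx
      rw [← hθβα x, hx, map_zero, map_zero]
    · exact fun b => ⟨_, LinearMap.mem_range_self (α j) (θ (β j b)), hβαθ _⟩
    · exact fun a ha => ⟨α j (θ (β j a)), ⟨hαA j _ (hθ _ (hβA j a ha)),
        LinearMap.mem_range_self _ _⟩, hβαθ _⟩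
  have hαθβ : ∀ y, α j (θ (β j y)) = y := fun y => hβinj (hβαθ _)
  refine ⟨j, ⟨LinearEquiv.ofLinearMap (α j ∘ₗ θ) (β j) (LinearMap.ext hαθβ) (LinearMap.ext hβαθ),
    le_antisymm ?_ fun y hy => ?_⟩, ?_⟩
  · rintro _ ⟨x, hx, rfl⟩
    exact hαA j _ (hθ x hx)
  · exact ⟨β j y, hβA j y hy, hαθβ y⟩
  · refine hπ.isDirectSum_update ((N' j).subtype ∘ₗ α j ∘ₗ θ ∘ₗ ρ) (fun b => Subtype.prop _)
      (fun y hy => ?_) (fun b hb => ?_) (fun b => ?_) (fun a ha => ?_)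
    · exact congrArg Subtype.val (hαθβ ⟨y, hy⟩)
    · have hρb : ρ b = 0 := Subtype.ext hb
      simp only [LinearMap.comp_apply, hρb, map_zero]
    · exact congrArg Subtype.val (hβαθ (ρ b))
    · exact hαA j _ (hθ _ (hπ.mem_sub i a ha))

/-- Any set of summands of finite length in a decomposition into indecomposable pairs can be
replaced by summands of another such decomposition. -/
theorem IsDirectSum.exists_exchange [DecidableEq ι] {A : Submodule Λ B}
    {N : ι → Submodule Λ B} {N' : κ → Submodule Λ B} (hN : IsDirectSum A N)
    (hNind : ∀ i, Indecomposable (summand A (N i))) (hN' : IsDirectSum A N')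
    (hN'ind : ∀ j, Indecomposable (summand A (N' j))) [IsNoetherian Λ B] (s : Finset ι)
    (hs : ∀ i ∈ s, IsArtinian Λ (N i)) :
    ∃ σ : ι → κ, (∀ i ∈ s, Iso (summand A (N i)) (summand A (N' (σ i)))) ∧
      IsDirectSum A fun i => if i ∈ s then N' (σ i) else N i := by
  induction s using Finset.induction_on with
  | empty =>
    -- For empty s the map σ only has to exist. If κ is empty, then B = 0, and no index i can carry
    -- a nonzero summand.
    by_cases hκ : Nonempty κ
    · exact ⟨fun _ => hκ.some, by simp, by simpa using hN⟩
    · have hB : Subsingleton B := by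
        have := not_nonempty_iff.mp hκ
        rw [← Submodule.subsingleton_iff Λ, ← subsingleton_iff_bot_eq_top, ← hN'.iSup_eq_top,
          iSup_of_empty]
      exact ⟨fun i => absurd (hNind i).1 (not_nontrivial _), by simp, by simpa using hN⟩
  | insert i s hi ih =>
    obtain ⟨σ, hσ, hsum⟩ := ih fun k hk => hs k (Finset.mem_insert_of_mem hk)
    have := hs i (Finset.mem_insert_self i s)
    obtain ⟨j, hj, hsum'⟩ := hsum.exchange hN' hN'ind i (X := N i) (by simp [hi]) (hNind i)
    refine ⟨Function.update σ i j, fun k hk => ?_, ?_⟩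
    · by_cases hki : k = i
      · subst hki
        rwa [Function.update_self]
      · rw [Function.update_of_ne hki]
        exact hσ k (Finset.mem_of_mem_insert_of_ne hk hki)
    · convert hsum' using 1
      funext k
      by_cases hki : k = i
      · subst hki
        simp
      · simp [hki]

/-- After the exchange the N' (σ i) are independent and nonzero, so no index can be used twice. -/
theorem IsDirectSum.exists_injOn [DecidableEq ι] {A : Submodule Λ B}
    {N : ι → Submodule Λ B} {N' : κ → Submodule Λ B} (hN : IsDirectSum A N)
    (hNind : ∀ i, Indecomposable (summand A (N i))) (hN' : IsDirectSum A N')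
    (hN'ind : ∀ j, Indecomposable (summand A (N' j))) [IsNoetherian Λ B] (s : Finset ι)
    (hs : ∀ i ∈ s, IsArtinian Λ (N i)) :
    ∃ σ : ι → κ, (∀ i ∈ s, Iso (summand A (N i)) (summand A (N' (σ i)))) ∧
      Set.InjOn σ s := by
  obtain ⟨σ, hσ, hsum⟩ := hN.exists_exchange hNind hN' hN'ind s hs
  refine ⟨σ, hσ, fun i hi k hk hik => ?_⟩
  by_contra hne
  have hdisj := hsum.indep.pairwiseDisjoint hne
  rw [Finset.mem_coe] at hi hk
  simp only [Function.onFun, hi, hk, if_true, hik, disjoint_self] at hdisj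
  exact Submodule.nontrivial_iff_ne_bot.mp (hN'ind (σ k)).1 hdisj

end Exchange

/-! ### Uniqueness: finite-length summands by exchange, free summands by rank. -/

section Uniqueness

variable {Λ : Type*} [CommRing Λ] [IsDomain Λ]

/-- Multiplication by q fits into the exact sequence Λ/(qⁿ) → Λ/(qⁿ⁺¹) → Λ/(q), whose last term is
simple. -/
theorem isArtinian_quotient_pow [IsPrincipalIdealRing Λ] {q : Λ} (hq : Prime q) (n : ℕ) :
    IsArtinian Λ (Λ ⧸ Ideal.span {q ^ n}) := by
  induction n with
  | zero =>
    have : Subsingleton (Λ ⧸ Ideal.span {q ^ 0}) := by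
      rw [Ideal.Quotient.subsingleton_iff, pow_zero, Ideal.span_singleton_one]
    infer_instance
  | succ n ih =>
    have hmax : (Ideal.span {q}).IsMaximal :=
      PrincipalIdealRing.isMaximal_of_irreducible hq.irreducible
    have hsimple : IsSimpleModule Λ (Λ ⧸ Ideal.span {q}) :=
      isSimpleModule_iff_isCoatom.mpr hmax.out
    have hz : ∀ r : Λ, Ideal.Quotient.mk (Ideal.span {r}) r = 0 := fun r =>
      (Ideal.Quotient.eq_zero_iff_dvd r r).mpr dvd_rfl
    have h1 : q ^ n • Ideal.Quotient.mk (Ideal.span {q ^ (n + 1)}) q = 0 := by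
      rw [← hz (q ^ (n + 1)), pow_succ]
      rfl
    have h2 : q ^ (n + 1) • Ideal.Quotient.mk (Ideal.span {q}) 1 = 0 := by
      exact (Ideal.Quotient.eq_zero_iff_dvd _ _).mpr (by simp [pow_succ])
    refine isArtinian_of_range_eq_ker (quotLift h1) (quotLift h2) ?_
    ext x
    obtain ⟨c, rfl⟩ := Ideal.Quotient.mk_surjective x
    rw [LinearMap.mem_range, LinearMap.mem_ker, quotLift_mk]
    constructor
    · rintro ⟨y, hy⟩
      obtain ⟨d, rfl⟩ := Ideal.Quotient.mk_surjective y
      rw [quotLift_mk] at hy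
      have hdvd := Ideal.mem_span_singleton.mp (Ideal.Quotient.eq.mp hy)
      refine (Ideal.Quotient.eq_zero_iff_dvd _ _).mpr ?_
      have hdvd' := (dvd_pow_self q n.succ_ne_zero).trans hdvd
      have := dvd_sub (Dvd.intro_left d rfl : q ∣ d * q) hdvd'
      simpa using this
    · intro hc
      have hdvd : q ∣ c * 1 := (Ideal.Quotient.eq_zero_iff_dvd _ _).mp hc
      obtain ⟨d, hd⟩ := hdvd
      refine ⟨Ideal.Quotient.mk _ d, ?_⟩
      rw [mul_one] at hd
      rw [quotLift_mk, hd, mul_comm]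
      rfl

/-- A listed pair that is not of type `(Λ; 0)` has finite length and is annihilated by a nonzero
element. -/
theorem IsListed.isArtinian_and_annihilated [IsPrincipalIdealRing Λ] {p : Λ} (hp : Prime p)
    {D : Type*} [AddCommGroup D] [Module Λ D] {C : Submodule Λ D} (h : IsListed p C)
    (hC : ¬ IsFreeType C) : IsArtinian Λ D ∧ ∃ r : Λ, r ≠ 0 ∧ ∀ d : D, r • d = 0 := by
  have htransfer : ∀ {F : Type _} [AddCommGroup F] [Module Λ F] (e : D ≃ₗ[Λ] F) (r : Λ),
      r ≠ 0 → (∀ x : F, r • x = 0) → ∃ r : Λ, r ≠ 0 ∧ ∀ d : D, r • d = 0 := by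
    intro F _ _ e r hr h
    exact ⟨r, hr, fun d => e.injective (by rw [map_smul, h, map_zero])⟩
  have hquot : ∀ (q r : Λ), q ∣ r → ∀ x : Λ ⧸ Ideal.span {q}, r • x = 0 := by
    intro q r hqr x
    obtain ⟨c, rfl⟩ := Ideal.Quotient.mk_surjective x
    exact (Ideal.Quotient.eq_zero_iff_dvd _ _).mpr (hqr.mul_right c)
  rcases h with ⟨q, hq, _, e, -⟩ | (⟨l, m, hl, _, _, e, -⟩ | ⟨t, s, hs, hst, e, -⟩) | hfree
  · obtain ⟨r, k, hr, hk, rfl⟩ := hq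
    have := isArtinian_quotient_pow hr k
    exact ⟨isArtinian_of_linearEquiv e.symm,
      htransfer e _ (pow_ne_zero k hr.ne_zero) (hquot _ _ dvd_rfl)⟩
  · have := isArtinian_quotient_pow hp l
    exact ⟨isArtinian_of_linearEquiv e.symm,
      htransfer e _ (pow_ne_zero l hp.ne_zero) (hquot _ _ dvd_rfl)⟩
  · have := isArtinian_quotient_pow hp t
    have := isArtinian_quotient_pow hp s
    exact ⟨isArtinian_of_linearEquiv e.symm,
      htransfer e _ (pow_ne_zero t hp.ne_zero) fun x =>
        Prod.ext (hquot _ _ dvd_rfl x.1) (hquot _ _ (pow_dvd_pow p (by omega)) x.2)⟩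
  · exact absurd hfree hC

variable {B : Type*} [AddCommGroup B] [Module Λ B]

/-- The number of free summands is the rank of the dual module. -/
theorem IsDirectSum.card_isFreeType {ι : Type*} [Fintype ι] {A : Submodule Λ B}
    {N : ι → Submodule Λ B} (hN : IsDirectSum A N)
    (h : ∀ i, ¬ IsFreeType (summand A (N i)) → ∃ r : Λ, r ≠ 0 ∧ ∀ x : N i, r • x = 0) :
    Nat.card {i // IsFreeType (summand A (N i))} = Module.finrank Λ (B →ₗ[Λ] Λ) := by
  classical
  -- Dualising kills each summand annihilated by a nonzero element, as Λ is a domain, and turns a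
  -- free summand into a copy of Λ.
  have hdual : ∀ i, Module.Free Λ (N i →ₗ[Λ] Λ) ∧ Module.Finite Λ (N i →ₗ[Λ] Λ) ∧
      Module.finrank Λ (N i →ₗ[Λ] Λ) = if IsFreeType (summand A (N i)) then 1 else 0 := by
    intro i
    by_cases hi : IsFreeType (summand A (N i))
    · obtain ⟨e, -⟩ := id hi
      let e' : Λ ≃ₗ[Λ] (N i →ₗ[Λ] Λ) :=
        (LinearMap.ringLmapEquivSelf Λ Λ Λ).symm.trans (e.symm.congrLeft Λ Λ)
      refine ⟨Module.Free.of_equiv e', Module.Finite.equiv e', ?_⟩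
      rw [if_pos hi, ← e'.finrank_eq, Module.finrank_self]
    · obtain ⟨r, hr, hr0⟩ := h i hi
      have : Subsingleton (N i →ₗ[Λ] Λ) := by
        refine ⟨fun f g => LinearMap.ext fun x => ?_⟩
        have hzero : ∀ f : N i →ₗ[Λ] Λ, f x = 0 := by
          intro f
          have hf : r • f x = 0 := by rw [← map_smul, hr0, map_zero]
          exact (smul_eq_zero.mp hf).resolve_left hr
        rw [hzero f, hzero g]
      refine ⟨inferInstance, inferInstance, ?_⟩
      rw [if_neg hi, Module.finrank_zero_of_subsingleton]
  have hfree := fun i => (hdual i).1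
  have hfin := fun i => (hdual i).2.1
  have hint := DirectSum.isInternal_submodule_of_iSupIndep_of_iSup_eq_top hN.indep hN.iSup_eq_top
  let e : (DirectSum ι fun i => N i) ≃ₗ[Λ] B :=
    LinearEquiv.ofBijective (DirectSum.coeLinearMap N) hint
  let e' : (∀ i, N i →ₗ[Λ] Λ) ≃ₗ[Λ] (B →ₗ[Λ] Λ) :=
    (DFinsupp.lsum Λ).trans (e.congrLeft Λ Λ)
  rw [← e'.finrank_eq, Module.finrank_pi_fintype, Finset.sum_congr rfl fun i _ => (hdual i).2.2,
    Finset.sum_boole, Nat.card_eq_fintype_card, Fintype.card_subtype]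
  simp

variable [IsPrincipalIdealRing Λ]

/-- Exchange in both directions gives injections between the finite sets of non-free summands, so
the first is bijective. The free summands are all isomorphic and equal in number, so any bijection
between them will do. -/
theorem IsDirectSum.exists_equiv {k l : ℕ} [Module.Finite Λ B] {p : Λ} (hp : Prime p)
    {A : Submodule Λ B} {N : Fin k → Submodule Λ B} {N' : Fin l → Submodule Λ B}
    (hN : IsDirectSum A N) (hNl : ∀ i, IsListed p (summand A (N i)))
    (hN' : IsDirectSum A N') (hNl' : ∀ j, IsListed p (summand A (N' j))) :
    ∃ σ : Fin k ≃ Fin l, ∀ i, Iso (summand A (N i)) (summand A (N' (σ i))) := by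
  classical
  have key : ∀ {k l : ℕ} {N : Fin k → Submodule Λ B} {N' : Fin l → Submodule Λ B},
      IsDirectSum A N → (∀ i, IsListed p (summand A (N i))) → IsDirectSum A N' →
      (∀ j, IsListed p (summand A (N' j))) →
      ∃ σ : {i // ¬ IsFreeType (summand A (N i))} → {j // ¬ IsFreeType (summand A (N' j))},
        Function.Injective σ ∧ ∀ i, Iso (summand A (N i.1)) (summand A (N' (σ i))) := by
    intro k l N N' hN hNl hN' hNl'
    obtain ⟨σ, hσ, hinj⟩ := hN.exists_injOn (fun i => (hNl i).indecomposable hp) hN'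
      (fun j => (hNl' j).indecomposable hp)
      (Finset.univ.filter fun i => ¬ IsFreeType (summand A (N i))) (fun i hi =>
        ((hNl i).isArtinian_and_annihilated hp (Finset.mem_filter.mp hi).2).1)
    have hmem : ∀ i : {i // ¬ IsFreeType (summand A (N i))},
        i.1 ∈ Finset.univ.filter fun i => ¬ IsFreeType (summand A (N i)) := fun i =>
      Finset.mem_filter.mpr ⟨Finset.mem_univ _, i.2⟩
    exact ⟨fun i => ⟨σ i, fun hf => i.2 ((hσ i (hmem i)).trans hf)⟩,
      fun i j hij => Subtype.ext (hinj (hmem i) (hmem j) (congrArg Subtype.val hij)),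
      fun i => hσ i (hmem i)⟩
  obtain ⟨σ, hσinj, hσ⟩ := key hN hNl hN' hNl'
  obtain ⟨τ, hτinj, -⟩ := key hN' hNl' hN hNl
  have hbij : Function.Bijective σ := (Fintype.bijective_iff_injective_and_card σ).mpr ⟨hσinj,
    le_antisymm (Fintype.card_le_of_injective σ hσinj) (Fintype.card_le_of_injective τ hτinj)⟩
  have hcard : Nat.card {i // IsFreeType (summand A (N i))} =
      Nat.card {j // IsFreeType (summand A (N' j))} := by
    rw [hN.card_isFreeType fun i hi => ((hNl i).isArtinian_and_annihilated hp hi).2,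
      hN'.card_isFreeType fun i hi => ((hNl' i).isArtinian_and_annihilated hp hi).2]
  let ε := Classical.choice (Finite.card_eq.mp hcard)
  let e : Fin k ≃ Fin l := (Equiv.sumCompl _).symm.trans
    ((Equiv.sumCongr ε (Equiv.ofBijective σ hbij)).trans (Equiv.sumCompl _))
  refine ⟨e, fun i => ?_⟩
  by_cases hi : IsFreeType (summand A (N i))
  · have hei : e i = (ε ⟨i, hi⟩).1 := by
      simp [e, Equiv.sumCompl_symm_apply_of_pos (p := fun i => IsFreeType (summand A (N i))) hi]
    rw [hei]
    exact Iso.trans hi (Iso.symm (ε ⟨i, hi⟩).2)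
  · have hei : e i = (σ ⟨i, hi⟩).1 := by
      simp [e, Equiv.sumCompl_symm_apply_of_neg (p := fun i => IsFreeType (summand A (N i))) hi]
    rw [hei]
    exact hσ ⟨i, hi⟩

end Uniqueness

end SubPair

theorem mainTheorem4 {Λ : Type u} [CommRing Λ] [IsDomain Λ] [IsPrincipalIdealRing Λ]
    (p : Λ) (hp : Prime p)
    {B : Type v} [AddCommGroup B] [Module Λ B] [Module.Finite Λ B]
    (A : Submodule Λ B) (hA : ∀ a ∈ A, p ^ 2 • a = 0) :
    -- every pair of one of the listed types is indecomposable
    (∀ (M : Type u) [AddCommGroup M] [Module Λ M] (C : Submodule Λ M),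
      SubPair.IsListed p C → SubPair.Indecomposable C) ∧
    -- existence of a decomposition into indecomposable pairs of the listed types
    (∃ (k : ℕ) (N : Fin k → Submodule Λ B), SubPair.IsDirectSum A N ∧
      ∀ i, SubPair.Indecomposable (SubPair.summand A (N i)) ∧
        SubPair.IsListed p (SubPair.summand A (N i))) ∧
    -- uniqueness among all finite decompositions into indecomposable pairs
    (∀ (k l : ℕ) (N : Fin k → Submodule Λ B) (N' : Fin l → Submodule Λ B),
      SubPair.IsDirectSum A N → (∀ i, SubPair.Indecomposable (SubPair.summand A (N i))) →
      SubPair.IsDirectSum A N' → (∀ j, SubPair.Indecomposable (SubPair.summand A (N' j))) →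
      ∃ σ : Fin k ≃ Fin l,
        ∀ i, SubPair.Iso (SubPair.summand A (N i)) (SubPair.summand A (N' (σ i)))) := by
  have hlisted : ∀ W : Submodule Λ B, SubPair.Indecomposable (SubPair.summand A W) →
      SubPair.IsListed p (SubPair.summand A W) := fun W hW =>
    hW.isListed hp fun a ha => Subtype.ext (hA a ha)
  refine ⟨fun M _ _ C hC => hC.indecomposable hp, ?_, ?_⟩
  · obtain ⟨k, N, hN, hind⟩ := SubPair.exists_isDirectSum_indecomposable A
    exact ⟨k, N, hN, fun i => ⟨hind i, hlisted _ (hind i)⟩⟩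
  · intro k l N N' hN hNind hN' hNind'
    exact hN.exists_equiv hp (fun i => hlisted _ (hNind i)) hN' fun j => hlisted _ (hNind' j)
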